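/- Let $n\ge 1$ and let $\mathbb S(2n)$ be the space of real symmetric $2n\times 2n$ matrices with inner product $\langle X,H\rangle=\operatorname{tr}(XH)$, and let $\mathbb P(2n)\subset\mathbb S(2n)$ be the open set of positive definite matrices. Put $J=\begin{pmatrix}0&I_n\\-I_n&0\end{pmatrix}$. For $A\in\mathbb P(2n)$ let $d_1(A)\le\dots\le d_n(A)$ be the symplectic eigenvalues of $A$, that is, the positive numbers such that $M^TAM=\begin{pmatrix}D&0\\0&D\end{pmatrix}$, $D=\operatorname{diag}(d_1(A),\dots,d_n(A))$, for some real $M$ with $M^TJM=J$. For $1\le m\le n$ let $S_m(A)$ be the set of normalised symplectic eigenvector pairs of $A$ for $d_m(A)$, i.e. of pairs $(x,y)\in\mathbb R^{2n}\times\mathbb R^{2n}$ with $$Ax=d_m(A)Jy,\qquad Ay=-d_m(A)Jx,\qquad \langle x,Jy\rangle=1 .$$ Regard $-d_m$ as a function $\mathbb S(2n)\to(-\infty,\infty]$ with value $+\infty$ outside $\mathbb P(2n)$. For such a function $f$, finite near $A$, put $$f^\circ(A;H)=\limsup_{X\to A,\ t\to0^+}\frac{f(X+tH)-f(X)}t,\qquad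 f^\diamond(A;H)=\sup_{X\in\mathbb S(2n)}\limsup_{t\to0^+}\frac{f(A+tX+tH)-f(A+tX)}t,$$ and let the Clarke subdifferential $\partial^\circ f(A)$ and the Michel--Penot subdifferential $\partial^\diamond f(A)$ be the sets of those $X\in\mathbb S(2n)$ such that for all $H\in\mathbb S(2n)$, respectively, $\langle X,H\rangle\le f^\circ(A;H)$ and $\langle X,H\rangle\le f^\diamond(A;H)$. **Theorem.** For every $A\in\mathbb P(2n)$ and every $1\le m\le n$, $$\partial^\circ(-d_m)(A)=\partial^\diamond(-d_m)(A)=\operatorname{conv}\Big\{-\tfrac12\,(xx^T+yy^T):(x,y)\in S_m(A)\Big\},$$ where $\operatorname{conv}$ denotes the closed convex hull in $\mathbb S(2n)$. In particular, if $d_m(A)=d_k(A)$, then $\partial^\circ(-d_m)(A)=\partial^\circ(-d_k)(A)$ and $\partial^\diamond(-d_m)(A)=\partial^\diamond(-d_k)(A)$. -/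

import Mathlib

open scoped Topology Matrix

noncomputable section

/-- The real vector space of symmetric real matrices, with the subspace topology. -/
def SymMat (ι : Type*) : Submodule ℝ (Matrix ι ι ℝ) where
  carrier := {A | A.IsSymm}
  add_mem' := fun ha hb => Matrix.IsSymm.add ha hb
  zero_mem' := Matrix.isSymm_zero
  smul_mem' := fun c _ ha => Matrix.IsSymm.smul ha c

namespace SymMat

variable {ι : Type*} [Fintype ι]

/-- The trace inner product `⟨A, B⟩ = tr (A B)`. -/
def traceInner (A B : SymMat ι) : ℝ :=
  Matrix.trace ((A : Matrix ι ι ℝ) * (B : Matrix ι ι ℝ))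

/-- The Clarke directional derivative
`limsup_{X → A, t → 0⁺} (f (X + t H) - f X) / t`, as an extended real number. -/
def clarkeDeriv (f : SymMat ι → EReal) (A H : SymMat ι) : EReal :=
  Filter.limsup (fun p : SymMat ι × ℝ => (f (p.1 + p.2 • H) - f p.1) / (p.2 : EReal))
    (𝓝 A ×ˢ 𝓝[>] (0 : ℝ))

/-- The Clarke subdifferential. -/
def clarkeSubdiff (f : SymMat ι → EReal) (A : SymMat ι) : Set (SymMat ι) :=
  {X | ∀ H : SymMat ι, (traceInner X H : EReal) ≤ clarkeDeriv f A H}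

/-- The Michel-Penot directional derivative
`sup_X limsup_{t → 0⁺} (f (A + t X + t H) - f (A + t X)) / t`, as an extended real number. -/
def michelPenotDeriv (f : SymMat ι → EReal) (A H : SymMat ι) : EReal :=
  ⨆ X : SymMat ι,
    Filter.limsup (fun t : ℝ => (f (A + t • X + t • H) - f (A + t • X)) / (t : EReal))
      (𝓝[>] (0 : ℝ))

/-- The Michel-Penot subdifferential. -/
def michelPenotSubdiff (f : SymMat ι → EReal) (A : SymMat ι) : Set (SymMat ι) :=
  {X | ∀ H : SymMat ι, (traceInner X H : EReal) ≤ michelPenotDeriv f A H}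

end SymMat

/-- The `2n × 2n` matrix `J = [[0, I], [-I, 0]]`. -/
def sympJ (n : ℕ) : Matrix (Fin n ⊕ Fin n) (Fin n ⊕ Fin n) ℝ :=
  Matrix.fromBlocks 0 1 (-1) 0

/-- `M` is symplectic: `Mᵀ J M = J`. -/
def IsSymplecticMatrix {n : ℕ} (M : Matrix (Fin n ⊕ Fin n) (Fin n ⊕ Fin n) ℝ) : Prop :=
  Mᵀ * sympJ n * M = sympJ n

/-- `d` is the increasingly ordered list of positive numbers in a Williamson normal form of `A`:
`Mᵀ A M = diag (D, D)` with `M` symplectic and `D = diag (d)`. -/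
def IsWilliamsonDiagonal {n : ℕ} (A : Matrix (Fin n ⊕ Fin n) (Fin n ⊕ Fin n) ℝ)
    (d : Fin n → ℝ) : Prop :=
  Monotone d ∧ (∀ j, 0 < d j) ∧
    ∃ M : Matrix (Fin n ⊕ Fin n) (Fin n ⊕ Fin n) ℝ, IsSymplecticMatrix M ∧
      Mᵀ * A * M = Matrix.fromBlocks (Matrix.diagonal d) 0 0 (Matrix.diagonal d)

open Classical in
/-- The ordered symplectic eigenvalues `d_1(A) ≤ ⋯ ≤ d_n(A)` (indexed from `0` here).
By Williamson's theorem the first branch is taken for every positive definite `A`, and the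
numbers are determined by `A`; other matrices get the value `0`, which is never used. -/
def sympEig {n : ℕ} (A : Matrix (Fin n ⊕ Fin n) (Fin n ⊕ Fin n) ℝ) : Fin n → ℝ :=
  if h : ∃ d : Fin n → ℝ, IsWilliamsonDiagonal A d then h.choose else 0

open Classical in
/-- The function `-d_m`, with values in `(-∞, ∞]`: it is extended by `+∞` outside the open set
of positive definite matrices. -/
def negSympEig {n : ℕ} (m : Fin n) (A : SymMat (Fin n ⊕ Fin n)) : EReal :=
  if (A : Matrix (Fin n ⊕ Fin n) (Fin n ⊕ Fin n) ℝ).PosDef then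
    ((-(sympEig (A : Matrix (Fin n ⊕ Fin n) (Fin n ⊕ Fin n) ℝ) m) : ℝ) : EReal)
  else ⊤

/-- The set of normalised symplectic eigenvector pairs `(x, y)` of `A` for `d_m(A)`:
`A x = d J y`, `A y = -d J x`, `⟨x, J y⟩ = 1` with `d = d_m(A)`. -/
def normalisedSympEigPairs {n : ℕ} (A : Matrix (Fin n ⊕ Fin n) (Fin n ⊕ Fin n) ℝ) (m : Fin n) :
    Set ((Fin n ⊕ Fin n → ℝ) × (Fin n ⊕ Fin n → ℝ)) :=
  {p | A *ᵥ p.1 = sympEig A m • (sympJ n *ᵥ p.2) ∧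
       A *ᵥ p.2 = -(sympEig A m • (sympJ n *ᵥ p.1)) ∧
       p.1 ⬝ᵥ (sympJ n *ᵥ p.2) = 1}

/-- The symmetric matrix `-½ (x xᵀ + y yᵀ)`. -/
def negHalfOuter {ι : Type*} (x y : ι → ℝ) : SymMat ι :=
  ⟨-((1 / 2 : ℝ) • (Matrix.vecMulVec x x + Matrix.vecMulVec y y)), by
    show Matrix.IsSymm _
    ext i j
    simp [Matrix.vecMulVec_apply, mul_comm]⟩

end

/-! The theorem follows from the cycle conv ⊆ ∂^⋄ ⊆ ∂^∘ ⊆ conv. The middle inclusion holds because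
the rays t ↦ A + tX are among the ways to approach A in the Clarke limsup.

Last inclusion. Testing the equations of an eigenvector pair of A + sH against a pair (x, y) of A
gives an exact identity (`IsSympEigPair.perturbation_identity`). By compactness of the pairs, it
shows that the right difference quotients of d_m along H cluster only at values ½(⟨x, Hx⟩ + ⟨y,
Hy⟩). Pairs of nearby matrices are close to pairs of A, so a mean value inequality along short
segments bounds the Clarke derivative by any c that strictly exceeds all values ⟨-½(xxᵀ + yyᵀ), H⟩
(`clarkeDeriv_negSympEig_le`). Hahn-Banach separation concludes.

First inclusion. Given (x, y), complete it to a Williamson basis with (x, y) in position m, and let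
X raise the levels from m on while leaving those below m fixed. Along A + tX the pair (x, y) is
detached from the lower levels, and the minimax principle bounds the increment of d_m in direction H
by t(½(⟨x, Hx⟩ + ⟨y, Hy⟩) + ε) (`exists_eventually_sympEig_sub_le`).

The minimax principle for pairs of vectors also yields uniqueness and continuity of the symplectic
eigenvalues. -/

/-! ### The symplectic form and a minimax principle for symplectic eigenvalues. -/

section SymplecticForm

variable {n : ℕ}

theorem sympJ_transpose : (sympJ n)ᵀ = -sympJ n := by
  simp [sympJ, Matrix.fromBlocks_transpose, Matrix.fromBlocks_neg]

theorem sympJ_mul_self : sympJ n * sympJ n = -1 := by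
  simp [sympJ, Matrix.fromBlocks_multiply, ← Matrix.fromBlocks_one, Matrix.fromBlocks_neg]

theorem dotProduct_mulVec_comm {ι : Type*} [Fintype ι] {B : Matrix ι ι ℝ} (hB : B.IsSymm)
    (x y : ι → ℝ) : x ⬝ᵥ B *ᵥ y = y ⬝ᵥ B *ᵥ x := by
  rw [Matrix.dotProduct_mulVec, ← Matrix.mulVec_transpose, hB.eq, dotProduct_comm]

theorem dotProduct_sympJ_mulVec_comm (x y : Fin n ⊕ Fin n → ℝ) :
    x ⬝ᵥ sympJ n *ᵥ y = -(y ⬝ᵥ sympJ n *ᵥ x) := by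
  rw [Matrix.dotProduct_mulVec, ← Matrix.mulVec_transpose, sympJ_transpose, dotProduct_comm,
    Matrix.neg_mulVec, dotProduct_neg]

theorem dotProduct_sympJ_mulVec_self (x : Fin n ⊕ Fin n → ℝ) : x ⬝ᵥ sympJ n *ᵥ x = 0 := by
  linarith [dotProduct_sympJ_mulVec_comm x x]

theorem dotProduct_sympJ_mulVec (x y : Fin n ⊕ Fin n → ℝ) :
    x ⬝ᵥ sympJ n *ᵥ y = ∑ j, (x (.inl j) * y (.inr j) - x (.inr j) * y (.inl j)) := by
  simp [sympJ, Matrix.fromBlocks_mulVec, dotProduct, Fintype.sum_sum_type, Matrix.neg_mulVec,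
    Finset.sum_add_distrib, sub_eq_add_neg]

theorem sympJ_mulVec_mulVec (x : Fin n ⊕ Fin n → ℝ) : sympJ n *ᵥ (sympJ n *ᵥ x) = -x := by
  rw [Matrix.mulVec_mulVec, sympJ_mul_self, Matrix.neg_mulVec, Matrix.one_mulVec]

theorem IsSymplecticMatrix.exists_mul_eq_one {M : Matrix (Fin n ⊕ Fin n) (Fin n ⊕ Fin n) ℝ}
    (hM : IsSymplecticMatrix M) : ∃ N, M * N = 1 := by
  refine ⟨-(sympJ n * Mᵀ * sympJ n), mul_eq_one_comm.mp ?_⟩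
  have h : Mᵀ * sympJ n * M = sympJ n := hM
  rw [neg_mul, Matrix.mul_assoc, Matrix.mul_assoc, ← Matrix.mul_assoc Mᵀ, h, sympJ_mul_self,
    neg_neg]

theorem mulVec_dotProduct_mulVec_mulVec {ι : Type*} [Fintype ι] (M B : Matrix ι ι ℝ)
    (x y : ι → ℝ) : (M *ᵥ x) ⬝ᵥ B *ᵥ (M *ᵥ y) = x ⬝ᵥ (Mᵀ * B * M) *ᵥ y := by
  rw [← Matrix.mulVec_mulVec, ← Matrix.mulVec_mulVec, Matrix.dotProduct_mulVec x,
    Matrix.vecMul_transpose]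

theorem dotProduct_fromBlocks_diagonal_mulVec (d : Fin n → ℝ) (x : Fin n ⊕ Fin n → ℝ) :
    x ⬝ᵥ (Matrix.fromBlocks (Matrix.diagonal d) 0 0 (Matrix.diagonal d)) *ᵥ x =
      ∑ j, d j * (x (.inl j) ^ 2 + x (.inr j) ^ 2) := by
  simp only [Matrix.fromBlocks_mulVec, dotProduct, Fintype.sum_sum_type, Sum.elim_inl,
    Sum.elim_inr, ← Finset.sum_add_distrib, Pi.add_apply, Matrix.zero_mulVec,
    Matrix.mulVec_diagonal, Function.comp, Pi.zero_apply]
  exact Finset.sum_congr rfl fun j _ => by ring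

/-- The form of `A` on the pair of vectors with complex coordinates `p - i q` in a basis of
eigenvector pairs, the columns of `M`. -/
theorem coordinate_pair_forms {A M : Matrix (Fin n ⊕ Fin n) (Fin n ⊕ Fin n) ℝ} {d : Fin n → ℝ}
    (hM : Mᵀ * A * M = Matrix.fromBlocks (Matrix.diagonal d) 0 0 (Matrix.diagonal d))
    (p q : Fin n → ℝ) :
    (M *ᵥ Sum.elim p q) ⬝ᵥ A *ᵥ (M *ᵥ Sum.elim p q) +
      (M *ᵥ Sum.elim (-q) p) ⬝ᵥ A *ᵥ (M *ᵥ Sum.elim (-q) p) =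
      2 * ∑ j, d j * (p j ^ 2 + q j ^ 2) := by
  rw [mulVec_dotProduct_mulVec_mulVec, mulVec_dotProduct_mulVec_mulVec, hM,
    dotProduct_fromBlocks_diagonal_mulVec, dotProduct_fromBlocks_diagonal_mulVec,
    ← Finset.sum_add_distrib, Finset.mul_sum]
  refine Finset.sum_congr rfl fun j _ => ?_
  simp only [Sum.elim_inl, Sum.elim_inr, Pi.neg_apply]
  ring

theorem coordinate_pair_sympJ {M : Matrix (Fin n ⊕ Fin n) (Fin n ⊕ Fin n) ℝ}
    (hM : IsSymplecticMatrix M) (p q : Fin n → ℝ) :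
    (M *ᵥ Sum.elim p q) ⬝ᵥ sympJ n *ᵥ (M *ᵥ Sum.elim (-q) p) = ∑ j, (p j ^ 2 + q j ^ 2) := by
  have h : Mᵀ * sympJ n * M = sympJ n := hM
  rw [mulVec_dotProduct_mulVec_mulVec, h, dotProduct_sympJ_mulVec]
  refine Finset.sum_congr rfl fun j _ => ?_
  simp only [Sum.elim_inl, Sum.elim_inr, Pi.neg_apply]
  ring

/-- Lower half of the minimax principle: on every real space of pairs of dimension larger than
`2 m`, the form of `A` is somewhere at least `d m` times the symplectic form. -/
theorem IsWilliamsonDiagonal.exists_ne_zero_le {A : Matrix (Fin n ⊕ Fin n) (Fin n ⊕ Fin n) ℝ}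
    {d : Fin n → ℝ} (h : IsWilliamsonDiagonal A d) (m : Fin n) {V : Type*} [AddCommGroup V]
    [Module ℝ V] [FiniteDimensional ℝ V] (f g : V →ₗ[ℝ] (Fin n ⊕ Fin n → ℝ))
    (hV : 2 * (m : ℕ) < Module.finrank ℝ V) :
    ∃ v, v ≠ 0 ∧ 2 * d m * (f v ⬝ᵥ sympJ n *ᵥ g v) ≤ f v ⬝ᵥ A *ᵥ f v + g v ⬝ᵥ A *ᵥ g v := by
  obtain ⟨hmono, hpos, M, hM, hA⟩ := h
  obtain ⟨N, hN⟩ := hM.exists_mul_eq_one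
  let f' := N.mulVecLin ∘ₗ f
  let g' := N.mulVecLin ∘ₗ g
  let e : Fin m → Fin n := fun j => ⟨j, j.2.trans m.2⟩
  -- Writing a, b and a', b' for the `inl`, `inr` coordinates of `f'` and `g'` at j, 4(ab' - ba') =
  -- (a + b')² + (b - a')² - (a - b')² - (b + a')². The 2m equations kill the positive squares for j
  -- < m, so the symplectic form is nonpositive there.
  let Φ : V →ₗ[ℝ] (Fin m → ℝ) × (Fin m → ℝ) :=
    (LinearMap.pi fun j => LinearMap.proj (.inl (e j)) ∘ₗ f' +
      LinearMap.proj (.inr (e j)) ∘ₗ g').prod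
    (LinearMap.pi fun j => LinearMap.proj (.inr (e j)) ∘ₗ f' -
      LinearMap.proj (.inl (e j)) ∘ₗ g')
  have hΦ : Φ.ker ≠ ⊥ := LinearMap.ker_ne_bot_of_finrank_lt (by simpa [two_mul] using hV)
  obtain ⟨v, hv, hv0⟩ := (Submodule.ne_bot_iff _).1 hΦ
  refine ⟨v, hv0, ?_⟩
  have hv' : Φ v = 0 := hv
  have hf : f v = M *ᵥ f' v := by simp [f', hN]
  have hg : g v = M *ᵥ g' v := by simp [g', hN]
  have hJ : Mᵀ * sympJ n * M = sympJ n := hM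
  rw [hf, hg, mulVec_dotProduct_mulVec_mulVec, mulVec_dotProduct_mulVec_mulVec,
    mulVec_dotProduct_mulVec_mulVec, hA, hJ, dotProduct_fromBlocks_diagonal_mulVec,
    dotProduct_fromBlocks_diagonal_mulVec, dotProduct_sympJ_mulVec, Finset.mul_sum,
    ← Finset.sum_add_distrib]
  refine Finset.sum_le_sum fun j _ => ?_
  have hm := hpos m
  have hj := hpos j
  by_cases hjm : j < m
  · have h1 : f' v (.inl j) + g' v (.inr j) = 0 := by
      simpa [Φ, e] using congrFun (congrArg Prod.fst hv') ⟨j, hjm⟩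
    have h2 : f' v (.inr j) - g' v (.inl j) = 0 := by
      simpa [Φ, e] using congrFun (congrArg Prod.snd hv') ⟨j, hjm⟩
    rw [eq_neg_of_add_eq_zero_right h1, ← sub_eq_zero.1 h2]
    have : 0 ≤ (2 * d m + 2 * d j) * (f' v (.inl j) ^ 2 + f' v (.inr j) ^ 2) := by positivity
    linarith
  · have h1 := hmono (not_lt.1 hjm)
    nlinarith [mul_nonneg hm.le (sq_nonneg (f' v (.inl j) - g' v (.inr j))),
      mul_nonneg hm.le (sq_nonneg (f' v (.inr j) + g' v (.inl j))),
      mul_nonneg (sub_nonneg.2 h1) (add_nonneg (add_nonneg (sq_nonneg (f' v (.inl j)))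
        (sq_nonneg (f' v (.inr j)))) (add_nonneg (sq_nonneg (g' v (.inl j)))
        (sq_nonneg (g' v (.inr j)))))]

/-- Upper half of the minimax principle, for trial pairs spanned by columns of a symplectic
matrix. -/
theorem IsWilliamsonDiagonal.le_of_forall_trial
    {B M : Matrix (Fin n ⊕ Fin n) (Fin n ⊕ Fin n) ℝ}
    {d : Fin n → ℝ} (h : IsWilliamsonDiagonal B d) (hM : IsSymplecticMatrix M) (m : Fin n) {c : ℝ}
    (hc : ∀ p q : Fin n → ℝ, (∀ j, m < j → p j = 0 ∧ q j = 0) →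
      (M *ᵥ Sum.elim p q) ⬝ᵥ B *ᵥ (M *ᵥ Sum.elim p q) +
      (M *ᵥ Sum.elim (-q) p) ⬝ᵥ B *ᵥ (M *ᵥ Sum.elim (-q) p) ≤
      2 * c * ∑ j, (p j ^ 2 + q j ^ 2)) : d m ≤ c := by
  -- Indices start at 0: the pairs up to and including `m` number `m + 1`, and their coefficients
  -- form a space of dimension 2m + 2 > 2m.
  let s : Fin (m + 1) → Fin n := fun j => ⟨j, by omega⟩
  have hs : Function.Injective s := fun i j hij => by
    simpa [s, Fin.ext_iff] using hij
  let E := Function.ExtendByZero.linearMap ℝ s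
  have hE0 : ∀ (p : Fin (m + 1) → ℝ) j, m < j → E p j = 0 := fun p j hj => by
    have : ¬ ∃ i, s i = j := by
      rintro ⟨i, rfl⟩
      have := Fin.lt_def.1 hj
      simp only [s] at this
      omega
    exact Function.extend_apply' p (fun _ => 0) j this
  have hEs : ∀ (p : Fin (m + 1) → ℝ) j, E p (s j) = p j := fun p j =>
    hs.extend_apply p (fun _ => 0) j
  let V := (Fin (m + 1) → ℝ) × (Fin (m + 1) → ℝ)
  let P : V →ₗ[ℝ] Fin n → ℝ := E ∘ₗ LinearMap.fst ℝ _ _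
  let Q : V →ₗ[ℝ] Fin n → ℝ := E ∘ₗ LinearMap.snd ℝ _ _
  let pair (f g : V →ₗ[ℝ] Fin n → ℝ) : V →ₗ[ℝ] (Fin n ⊕ Fin n → ℝ) :=
    LinearMap.pi (Sum.rec (fun j => LinearMap.proj j ∘ₗ f) (fun j => LinearMap.proj j ∘ₗ g))
  have hpair : ∀ f g v, pair f g v = Sum.elim (f v) (g v) := fun f g v => by
    ext (j | j) <;> rfl
  obtain ⟨v, hv0, hv⟩ := h.exists_ne_zero_le m (M.mulVecLin ∘ₗ pair P Q)
    (M.mulVecLin ∘ₗ pair (-Q) P) (V := V) (by simp [V]; omega)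
  simp only [LinearMap.comp_apply, Matrix.mulVecLin_apply, hpair, LinearMap.neg_apply] at hv
  rw [coordinate_pair_sympJ hM] at hv
  have h1 := hv.trans (hc (P v) (Q v) fun j hj => ⟨hE0 _ _ hj, hE0 _ _ hj⟩)
  have hS : 0 < ∑ j, (P v j ^ 2 + Q v j ^ 2) := by
    refine (Finset.sum_nonneg fun j _ => by positivity).lt_of_ne' fun h0 => hv0 ?_
    rw [Finset.sum_eq_zero_iff_of_nonneg fun j _ => by positivity] at h0
    have h0' : ∀ j, v.1 j = 0 ∧ v.2 j = 0 := fun j => by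
      have : v.1 j ^ 2 + v.2 j ^ 2 = 0 := by
        rw [← hEs v.1, ← hEs v.2]
        exact h0 (s j) (Finset.mem_univ _)
      constructor <;> nlinarith [sq_nonneg (v.1 j), sq_nonneg (v.2 j)]
    exact Prod.ext (funext fun j => (h0' j).1) (funext fun j => (h0' j).2)
  have := le_of_mul_le_mul_right h1 hS
  linarith

/-- The trial pairs are the first columns of a matrix diagonalising `A`. The case c = 1 gives
uniqueness of the eigenvalues, and c slightly above 1 gives continuity. -/
theorem IsWilliamsonDiagonal.le_mul_of_le {A B : Matrix (Fin n ⊕ Fin n) (Fin n ⊕ Fin n) ℝ}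
    {d e : Fin n → ℝ} (hA : IsWilliamsonDiagonal A d) (hB : IsWilliamsonDiagonal B e) {c : ℝ}
    (hc : 0 ≤ c) (h : ∀ x, x ⬝ᵥ B *ᵥ x ≤ c * (x ⬝ᵥ A *ᵥ x)) (m : Fin n) : e m ≤ c * d m := by
  obtain ⟨hmono, hpos, M, hM, hAM⟩ := hA
  refine hB.le_of_forall_trial hM m fun p q hpq => (add_le_add (h _) (h _)).trans ?_
  rw [← mul_add, coordinate_pair_forms hAM]
  have : ∑ j, d j * (p j ^ 2 + q j ^ 2) ≤ d m * ∑ j, (p j ^ 2 + q j ^ 2) := by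
    rw [Finset.mul_sum]
    refine Finset.sum_le_sum fun j _ => ?_
    rcases le_or_gt j m with hj | hj
    · exact mul_le_mul_of_nonneg_right (hmono hj) (by positivity)
    · simp [hpq j hj]
  nlinarith [mul_le_mul_of_nonneg_left this hc]

theorem IsWilliamsonDiagonal.unique {A : Matrix (Fin n ⊕ Fin n) (Fin n ⊕ Fin n) ℝ}
    {d e : Fin n → ℝ} (hd : IsWilliamsonDiagonal A d) (he : IsWilliamsonDiagonal A e) : d = e := by
  funext m
  refine le_antisymm ?_ ?_
  · simpa using he.le_mul_of_le hd zero_le_one (fun x => by simp) m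
  · simpa using hd.le_mul_of_le he zero_le_one (fun x => by simp) m

theorem IsWilliamsonDiagonal.sympEig_eq {A : Matrix (Fin n ⊕ Fin n) (Fin n ⊕ Fin n) ℝ}
    {d : Fin n → ℝ} (h : IsWilliamsonDiagonal A d) : sympEig A = d := by
  have hex : ∃ d : Fin n → ℝ, IsWilliamsonDiagonal A d := ⟨d, h⟩
  rw [sympEig, dif_pos hex]
  exact hex.choose_spec.unique h

end SymplecticForm

/-! ### Williamson's theorem, with a prescribed eigenvector pair. -/

section Williamson

variable {n : ℕ}

/-- `(x, y)` is a normalised symplectic eigenvector pair of `A` for the number `δ`. -/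
def IsSympEigPair (A : Matrix (Fin n ⊕ Fin n) (Fin n ⊕ Fin n) ℝ) (δ : ℝ)
    (x y : Fin n ⊕ Fin n → ℝ) : Prop :=
  A *ᵥ x = δ • (sympJ n *ᵥ y) ∧ A *ᵥ y = -(δ • (sympJ n *ᵥ x)) ∧ x ⬝ᵥ (sympJ n *ᵥ y) = 1

theorem Matrix.PosDef.dotProduct_pos {ι : Type*} [Fintype ι] {A : Matrix ι ι ℝ} (hA : A.PosDef)
    {x : ι → ℝ} (hx : x ≠ 0) : 0 < x ⬝ᵥ A *ᵥ x := by
  simpa using hA.dotProduct_mulVec_pos hx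

theorem Matrix.PosDef.dotProduct_nonneg {ι : Type*} [Fintype ι] {A : Matrix ι ι ℝ}
    (hA : A.PosDef) (x : ι → ℝ) : 0 ≤ x ⬝ᵥ A *ᵥ x := by
  rcases eq_or_ne x 0 with rfl | hx
  · simp
  · exact (hA.dotProduct_pos hx).le

theorem Matrix.PosDef.eq_zero_of_dotProduct {ι : Type*} [Fintype ι] {A : Matrix ι ι ℝ}
    (hA : A.PosDef) {x : ι → ℝ} (hx : x ⬝ᵥ A *ᵥ x = 0) : x = 0 := by
  by_contra h
  exact (hA.dotProduct_pos h).ne' hx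

theorem Matrix.PosDef.isSymm_real {ι : Type*} {A : Matrix ι ι ℝ} (hA : A.PosDef) :
    A.IsSymm := by
  have := hA.isHermitian
  rwa [Matrix.IsHermitian, Matrix.conjTranspose_eq_transpose_of_trivial] at this

theorem IsSympEigPair.dotProduct_left {A : Matrix (Fin n ⊕ Fin n) (Fin n ⊕ Fin n) ℝ} {δ : ℝ}
    {x y : Fin n ⊕ Fin n → ℝ} (h : IsSympEigPair A δ x y) : x ⬝ᵥ A *ᵥ x = δ := by
  rw [h.1, dotProduct_smul, h.2.2, smul_eq_mul, mul_one]

theorem IsSympEigPair.dotProduct_right {A : Matrix (Fin n ⊕ Fin n) (Fin n ⊕ Fin n) ℝ} {δ : ℝ}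
    {x y : Fin n ⊕ Fin n → ℝ} (h : IsSympEigPair A δ x y) : y ⬝ᵥ A *ᵥ y = δ := by
  rw [h.2.1, dotProduct_neg, dotProduct_smul, dotProduct_sympJ_mulVec_comm, h.2.2]
  simp

theorem IsSympEigPair.pos {A : Matrix (Fin n ⊕ Fin n) (Fin n ⊕ Fin n) ℝ} (hA : A.PosDef) {δ : ℝ}
    {x y : Fin n ⊕ Fin n → ℝ} (h : IsSympEigPair A δ x y) : 0 < δ := by
  rw [← h.dotProduct_left]
  refine hA.dotProduct_pos ?_
  rintro rfl
  simpa using h.2.2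

theorem eq_zero_of_forall_nonneg_mul_add {a b : ℝ} (h : ∀ t : ℝ, 0 ≤ t * a + t ^ 2 * b) :
    a = 0 := by
  have hb : 0 ≤ b := by linarith [h 1, h (-1)]
  -- The shift by 1 keeps the denominator positive when b = 0.
  have h1 := h (-a / (b + 1))
  have h2 : -a / (b + 1) * a + (-a / (b + 1)) ^ 2 * b = -(a / (b + 1)) ^ 2 := by
    field_simp
    ring
  rw [h2] at h1
  have h3 : a / (b + 1) = 0 := by nlinarith [sq_nonneg (a / (b + 1))]
  rcases div_eq_zero_iff.1 h3 with h4 | h4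
  · exact h4
  · linarith

/-- A nonzero subspace invariant under `A⁻¹ J` contains a symplectic eigenvector pair. -/
theorem exists_isSympEigPair_mem {A : Matrix (Fin n ⊕ Fin n) (Fin n ⊕ Fin n) ℝ} (hA : A.PosDef)
    (W : Submodule ℝ (Fin n ⊕ Fin n → ℝ)) (hW : W ≠ ⊥)
    (T : (Fin n ⊕ Fin n → ℝ) → (Fin n ⊕ Fin n → ℝ)) (hT : ∀ w, A *ᵥ T w = sympJ n *ᵥ w)
    (hTW : ∀ w ∈ W, T w ∈ W) :
    ∃ δ, ∃ x ∈ W, ∃ y ∈ W, IsSympEigPair A δ x y := by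
  let q : (Fin n ⊕ Fin n → ℝ) × (Fin n ⊕ Fin n → ℝ) → ℝ := fun z =>
    z.1 ⬝ᵥ A *ᵥ z.1 + z.2 ⬝ᵥ A *ᵥ z.2
  let k : (Fin n ⊕ Fin n → ℝ) × (Fin n ⊕ Fin n → ℝ) → ℝ := fun z => z.1 ⬝ᵥ sympJ n *ᵥ z.2
  have hq0 : ∀ z, z ≠ 0 → 0 < q z := fun z hz => by
    rcases eq_or_ne z.1 0 with h1 | h1
    · have h2 : z.2 ≠ 0 := fun h2 => hz (Prod.ext h1 h2)
      exact add_pos_of_nonneg_of_pos (hA.dotProduct_nonneg _) (hA.dotProduct_pos h2)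
    · exact add_pos_of_pos_of_nonneg (hA.dotProduct_pos h1) (hA.dotProduct_nonneg _)
  have hqs : ∀ (c : ℝ) z, q (c • z) = c ^ 2 * q z := fun c z => by
    simp only [q, Prod.smul_fst, Prod.smul_snd, Matrix.mulVec_smul, smul_dotProduct,
      dotProduct_smul, smul_eq_mul]
    ring
  have hks : ∀ (c : ℝ) z, k (c • z) = c ^ 2 * k z := fun c z => by
    simp only [k, Prod.smul_fst, Prod.smul_snd, Matrix.mulVec_smul, smul_dotProduct,
      dotProduct_smul, smul_eq_mul]
    ring
  have hqc : Continuous q := by fun_prop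
  have hkc : Continuous k := by fun_prop
  let S : Set ((Fin n ⊕ Fin n → ℝ) × (Fin n ⊕ Fin n → ℝ)) :=
    Metric.sphere 0 1 ∩ (W.prod W : Set _)
  have hS : IsCompact S := (isCompact_sphere _ _).inter_right (W.prod W).closed_of_finiteDimensional
  have hnorm : ∀ z ∈ W.prod W, z ≠ 0 → ‖z‖⁻¹ • z ∈ S := fun z hz hz0 =>
    ⟨by simp [norm_smul, hz0], (W.prod W).smul_mem _ hz⟩
  obtain ⟨w, hw, hw0⟩ := (Submodule.ne_bot_iff _).1 hW
  -- The quotient k / q is homogeneous of degree 0, so its maximum c on the unit sphere of W × W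
  -- bounds it on all nonzero pairs, and the nonnegative form c q - k vanishes at the maximiser.
  obtain ⟨z, hzS, hzmax⟩ := hS.exists_isMaxOn
    ⟨_, hnorm (w, 0) ⟨hw, W.zero_mem⟩ (by simpa using hw0)⟩
    (f := fun z => k z / q z)
    (hkc.continuousOn.div hqc.continuousOn fun z hz => (hq0 z (by
      rintro rfl
      simpa using hz.1)).ne')
  obtain ⟨x, y⟩ := z
  have hz0 : (x, y) ≠ (0 : (Fin n ⊕ Fin n → ℝ) × (Fin n ⊕ Fin n → ℝ)) := fun h => by
    have := hzS.1
    simp [h] at this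
  have hx : x ∈ W := hzS.2.1
  have hy : y ∈ W := hzS.2.2
  set c := k (x, y) / q (x, y) with hc
  have hle : ∀ z ∈ W.prod W, k z ≤ c * q z := fun z hz => by
    rcases eq_or_ne z 0 with rfl | hz0
    · simp [k, q]
    · have h1 : k (‖z‖⁻¹ • z) / q (‖z‖⁻¹ • z) ≤ c := hzmax (hnorm z hz hz0)
      rw [hks, hqs, mul_div_mul_left _ _ (by simpa using hz0), div_le_iff₀ (hq0 z hz0)] at h1
      exact h1
  have hceq : k (x, y) = c * q (x, y) := by
    rw [hc, div_mul_cancel₀ _ (hq0 _ hz0).ne']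
  have hTw : T w ≠ 0 := fun h => by
    have h1 := hT w
    rw [h, Matrix.mulVec_zero] at h1
    have h2 := sympJ_mulVec_mulVec w
    rw [← h1, Matrix.mulVec_zero] at h2
    exact hw0 (neg_eq_zero.1 h2.symm)
  have hcpos : 0 < c := by
    have h1 := hle (T w, w) ⟨hTW w hw, hw⟩
    have h2 : 0 < k (T w, w) := by
      have := hA.dotProduct_pos hTw
      rwa [hT] at this
    have h3 := hq0 (T w, w) (fun h => hw0 (congrArg Prod.snd h))
    exact pos_of_mul_pos_left (h2.trans_le h1) h3.le
  have hpolar : ∀ h ∈ W, ∀ l ∈ W,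
      2 * c * (h ⬝ᵥ A *ᵥ x + l ⬝ᵥ A *ᵥ y) - (h ⬝ᵥ sympJ n *ᵥ y - l ⬝ᵥ sympJ n *ᵥ x) = 0 := by
    intro h hh l hl
    refine eq_zero_of_forall_nonneg_mul_add (b := c * q (h, l) - k (h, l)) fun t => ?_
    have h1 := hle (x + t • h, y + t • l)
      ⟨W.add_mem hx (W.smul_mem t hh), W.add_mem hy (W.smul_mem t hl)⟩
    have h2 := dotProduct_mulVec_comm hA.isSymm_real x h
    have h3 := dotProduct_mulVec_comm hA.isSymm_real y l
    have h4 := dotProduct_sympJ_mulVec_comm x l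
    simp only [q, k, Matrix.mulVec_add, Matrix.mulVec_smul, add_dotProduct, dotProduct_add,
      smul_dotProduct, dotProduct_smul, smul_eq_mul, h2, h3, h4] at h1 hceq ⊢
    linarith
  -- Criticality is known only against vectors of W. Since T preserves W, the residual 2c x - T y is
  -- itself an admissible test vector, and its A-norm vanishes.
  have hxeq : (2 * c) • A *ᵥ x = sympJ n *ᵥ y := by
    have h1 := hpolar ((2 * c) • x - T y) (W.sub_mem (W.smul_mem _ hx) (hTW y hy)) 0 W.zero_mem
    have h2 : (2 * c) • x - T y = 0 := by
      refine hA.eq_zero_of_dotProduct ?_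
      rw [Matrix.mulVec_sub, Matrix.mulVec_smul, hT, dotProduct_sub, dotProduct_smul, smul_eq_mul]
      simpa using h1
    rw [← Matrix.mulVec_smul, sub_eq_zero.1 h2, hT]
  have hyeq : (2 * c) • A *ᵥ y = -(sympJ n *ᵥ x) := by
    have h1 := hpolar 0 W.zero_mem ((2 * c) • y + T x) (W.add_mem (W.smul_mem _ hy) (hTW x hx))
    have h2 : (2 * c) • y + T x = 0 := by
      refine hA.eq_zero_of_dotProduct ?_
      rw [Matrix.mulVec_add, Matrix.mulVec_smul, hT, dotProduct_add, dotProduct_smul, smul_eq_mul]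
      simp only [zero_dotProduct, zero_add, zero_sub, sub_neg_eq_add] at h1
      exact h1
    rw [← Matrix.mulVec_smul, eq_neg_of_add_eq_zero_left h2, Matrix.mulVec_neg, hT]
  have hkpos : 0 < k (x, y) := by
    rw [hceq]
    exact mul_pos hcpos (hq0 _ hz0)
  have hsq := Real.mul_self_sqrt hkpos.le
  have hs0 : √(k (x, y)) ≠ 0 := (Real.sqrt_pos.2 hkpos).ne'
  refine ⟨(2 * c)⁻¹, (√(k (x, y)))⁻¹ • x, W.smul_mem _ hx, (√(k (x, y)))⁻¹ • y,
    W.smul_mem _ hy, ?_, ?_, ?_⟩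
  · rw [Matrix.mulVec_smul, Matrix.mulVec_smul, ← hxeq, smul_comm, inv_smul_smul₀ (by positivity)]
  · rw [Matrix.mulVec_smul, Matrix.mulVec_smul, smul_comm, ← smul_neg, ← smul_neg, ← hyeq,
      inv_smul_smul₀ (by positivity)]
  · rw [Matrix.mulVec_smul, smul_dotProduct, dotProduct_smul, smul_eq_mul, smul_eq_mul]
    change _ * (_ * k (x, y)) = 1
    field_simp
    rw [Real.sq_sqrt hkpos.le]

/-- A family of symplectic eigenvector pairs indexed by `s` that is part of a symplectic basis. -/
structure IsSympEigFamily (A : Matrix (Fin n ⊕ Fin n) (Fin n ⊕ Fin n) ℝ) (s : Finset (Fin n))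
    (δ : Fin n → ℝ) (x y : Fin n → Fin n ⊕ Fin n → ℝ) : Prop where
  pair : ∀ i ∈ s, IsSympEigPair A (δ i) (x i) (y i)
  left_left : ∀ i ∈ s, ∀ j ∈ s, i ≠ j → x i ⬝ᵥ sympJ n *ᵥ x j = 0
  left_right : ∀ i ∈ s, ∀ j ∈ s, i ≠ j → x i ⬝ᵥ sympJ n *ᵥ y j = 0
  right_right : ∀ i ∈ s, ∀ j ∈ s, i ≠ j → y i ⬝ᵥ sympJ n *ᵥ y j = 0

/-- The symplectic complement of the family is cut out by 2|s| < 2n equations, so it is nonzero; it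
is invariant under A⁻¹J because the family consists of eigenvector pairs. A further pair is found
inside it. Keeping the old pairs unchanged is what later allows one pair to be prescribed. -/
theorem IsSympEigFamily.exists_insert {A : Matrix (Fin n ⊕ Fin n) (Fin n ⊕ Fin n) ℝ}
    (hA : A.PosDef) {s : Finset (Fin n)} {δ : Fin n → ℝ} {x y : Fin n → Fin n ⊕ Fin n → ℝ}
    (h : IsSympEigFamily A s δ x y) {a : Fin n} (ha : a ∉ s) :
    ∃ δ' x' y', IsSympEigFamily A (insert a s) δ' x' y' ∧ ∀ i ∈ s, x' i = x i ∧ y' i = y i := by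
  let Φ : (Fin n ⊕ Fin n → ℝ) →ₗ[ℝ] (s → ℝ) × (s → ℝ) :=
    (LinearMap.pi fun i : s => dotProductBilin ℝ ℝ (sympJ n *ᵥ x i)).prod
    (LinearMap.pi fun i : s => dotProductBilin ℝ ℝ (sympJ n *ᵥ y i))
  have hΦ : ∀ w, w ∈ Φ.ker ↔ ∀ i ∈ s, w ⬝ᵥ sympJ n *ᵥ x i = 0 ∧ w ⬝ᵥ sympJ n *ᵥ y i = 0 := by
    intro w
    simp only [LinearMap.mem_ker, Φ, LinearMap.prod_apply, Function.prod, Prod.mk_eq_zero, funext_iff,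
      LinearMap.pi_apply, dotProductBilin_apply_apply, Subtype.forall, Pi.zero_apply,
      dotProduct_comm w]
    exact ⟨fun h i hi => ⟨h.1 i hi, h.2 i hi⟩, fun h => ⟨fun i hi => (h i hi).1,
      fun i hi => (h i hi).2⟩⟩
  have hcard : s.card < n := by
    have := Finset.card_lt_univ_of_notMem ha
    simpa using this
  have hker : Φ.ker ≠ ⊥ := LinearMap.ker_ne_bot_of_finrank_lt (by simp; omega)
  have hT : ∀ w, A *ᵥ (A⁻¹ *ᵥ (sympJ n *ᵥ w)) = sympJ n *ᵥ w := fun w => by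
    rw [Matrix.mulVec_mulVec, Matrix.mul_nonsing_inv _ ((Matrix.isUnit_iff_isUnit_det _).1
      hA.isUnit), Matrix.one_mulVec]
  obtain ⟨ε, u, hu, v, hv, huv⟩ := exists_isSympEigPair_mem hA Φ.ker hker
    (fun w => A⁻¹ *ᵥ (sympJ n *ᵥ w)) hT fun w hw => by
      rw [hΦ] at hw ⊢
      intro i hi
      have hp := h.pair i hi
      have hδ := (hp.pos hA).ne'
      have h1 := dotProduct_mulVec_comm hA.isSymm_real (A⁻¹ *ᵥ (sympJ n *ᵥ w)) (x i)
      have h2 := dotProduct_mulVec_comm hA.isSymm_real (A⁻¹ *ᵥ (sympJ n *ᵥ w)) (y i)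
      rw [hT, dotProduct_sympJ_mulVec_comm] at h1 h2
      rw [hp.1, (hw i hi).1, dotProduct_smul] at h1
      rw [hp.2.1, (hw i hi).2, dotProduct_neg, dotProduct_smul] at h2
      simp only [smul_eq_mul, neg_zero, neg_eq_zero, mul_eq_zero, hδ, false_or] at h1 h2
      exact ⟨h2, h1⟩
  rw [hΦ] at hu hv
  have hne : ∀ i ∈ s, i ≠ a := fun i hi hia => ha (hia ▸ hi)
  refine ⟨Function.update δ a ε, Function.update x a u, Function.update y a v, ⟨?_, ?_, ?_, ?_⟩,
    fun i hi => by simp [hne i hi]⟩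
  · intro i hi
    rcases Finset.mem_insert.1 hi with rfl | hi
    · simpa using huv
    · simpa [hne i hi] using h.pair i hi
  all_goals
    intro i hi j hj hij
    rcases Finset.mem_insert.1 hi with rfl | hi' <;> rcases Finset.mem_insert.1 hj with rfl | hj
    · exact absurd rfl hij
  · simpa [hne j hj] using (hu j hj).1
  · simpa [hne i hi', dotProduct_sympJ_mulVec_comm (x i)] using (hu i hi').1
  · simpa [hne i hi', hne j hj] using h.left_left i hi' j hj hij
  · simpa [hne j hj] using (hu j hj).2
  · simpa [hne i hi', dotProduct_sympJ_mulVec_comm (x i)] using (hv i hi').1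
  · simpa [hne i hi', hne j hj] using h.left_right i hi' j hj hij
  · simpa [hne j hj] using (hv j hj).2
  · simpa [hne i hi', dotProduct_sympJ_mulVec_comm (y i)] using (hv i hi').2
  · simpa [hne i hi', hne j hj] using h.right_right i hi' j hj hij

theorem IsSympEigFamily.exists_univ {A : Matrix (Fin n ⊕ Fin n) (Fin n ⊕ Fin n) ℝ}
    (hA : A.PosDef) {s : Finset (Fin n)} {δ : Fin n → ℝ} {x y : Fin n → Fin n ⊕ Fin n → ℝ}
    (h : IsSympEigFamily A s δ x y) :
    ∃ δ' x' y', IsSympEigFamily A Finset.univ δ' x' y' ∧ ∀ i ∈ s, x' i = x i ∧ y' i = y i := by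
  suffices H : ∀ t : Finset (Fin n), ∃ δ' x' y', IsSympEigFamily A (t ∪ s) δ' x' y' ∧
      ∀ i ∈ s, x' i = x i ∧ y' i = y i by
    simpa only [Finset.union_eq_left.2 (Finset.subset_univ s)] using H Finset.univ
  intro t
  induction t using Finset.induction_on with
  | empty => exact ⟨δ, x, y, by simpa using h, fun _ _ => ⟨rfl, rfl⟩⟩
  | insert a t _ ih =>
    obtain ⟨δ', x', y', h', hs⟩ := ih
    rw [Finset.insert_union]
    by_cases ha : a ∈ t ∪ s
    · exact ⟨δ', x', y', by rwa [Finset.insert_eq_of_mem ha], hs⟩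
    · obtain ⟨δ'', x'', y'', h'', hs'⟩ := h'.exists_insert hA ha
      refine ⟨δ'', x'', y'', h'', fun i hi => ?_⟩
      obtain ⟨h1, h2⟩ := hs' i (Finset.mem_union_right _ hi)
      exact ⟨h1.trans (hs i hi).1, h2.trans (hs i hi).2⟩

theorem IsSympEigFamily.comp_equiv {A : Matrix (Fin n ⊕ Fin n) (Fin n ⊕ Fin n) ℝ}
    {δ : Fin n → ℝ} {x y : Fin n → Fin n ⊕ Fin n → ℝ}
    (h : IsSympEigFamily A Finset.univ δ x y) (σ : Equiv.Perm (Fin n)) :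
    IsSympEigFamily A Finset.univ (δ ∘ σ) (x ∘ σ) (y ∘ σ) where
  pair i _ := h.pair (σ i) (Finset.mem_univ _)
  left_left _ _ _ _ hij := h.left_left _ (Finset.mem_univ _) _ (Finset.mem_univ _)
    (σ.injective.ne hij)
  left_right _ _ _ _ hij := h.left_right _ (Finset.mem_univ _) _ (Finset.mem_univ _)
    (σ.injective.ne hij)
  right_right _ _ _ _ hij := h.right_right _ (Finset.mem_univ _) _ (Finset.mem_univ _)
    (σ.injective.ne hij)

/-- The matrix with columns `x 1, …, x n, y 1, …, y n`. -/
def pairColumns (x y : Fin n → Fin n ⊕ Fin n → ℝ) : Matrix (Fin n ⊕ Fin n) (Fin n ⊕ Fin n) ℝ :=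
  Matrix.of fun i j => Sum.elim x y j i

theorem transpose_mul_mul_pairColumns_apply (x y : Fin n → Fin n ⊕ Fin n → ℝ)
    (B : Matrix (Fin n ⊕ Fin n) (Fin n ⊕ Fin n) ℝ) (i j : Fin n ⊕ Fin n) :
    ((pairColumns x y)ᵀ * B * pairColumns x y) i j =
      Sum.elim x y i ⬝ᵥ B *ᵥ Sum.elim x y j := by
  have h : ∀ j, Sum.elim x y j = pairColumns x y *ᵥ Pi.single j 1 := fun j => by
    rw [Matrix.mulVec_single_one]
    rfl
  rw [h, h, mulVec_dotProduct_mulVec_mulVec, Matrix.mulVec_single_one, single_one_dotProduct]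
  rfl

@[simp] theorem sympJ_inl_inl (i j : Fin n) : sympJ n (.inl i) (.inl j) = 0 := rfl

@[simp] theorem sympJ_inl_inr (i j : Fin n) :
    sympJ n (.inl i) (.inr j) = (1 : Matrix (Fin n) (Fin n) ℝ) i j := rfl

@[simp] theorem sympJ_inr_inl (i j : Fin n) :
    sympJ n (.inr i) (.inl j) = -(1 : Matrix (Fin n) (Fin n) ℝ) i j := rfl

@[simp] theorem sympJ_inr_inr (i j : Fin n) : sympJ n (.inr i) (.inr j) = 0 := rfl

theorem IsSympEigFamily.isSymplecticMatrix {A : Matrix (Fin n ⊕ Fin n) (Fin n ⊕ Fin n) ℝ}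
    {δ : Fin n → ℝ} {x y : Fin n → Fin n ⊕ Fin n → ℝ}
    (h : IsSympEigFamily A Finset.univ δ x y) : IsSymplecticMatrix (pairColumns x y) := by
  rw [IsSymplecticMatrix]
  ext i j
  rw [transpose_mul_mul_pairColumns_apply]
  rcases i with i | i <;> rcases j with j | j <;> rcases eq_or_ne i j with rfl | hij
  · simp [dotProduct_sympJ_mulVec_self]
  · simp [h.left_left i (Finset.mem_univ _) j (Finset.mem_univ _) hij]
  · simp [(h.pair i (Finset.mem_univ _)).2.2]
  · simp [h.left_right i (Finset.mem_univ _) j (Finset.mem_univ _) hij, hij]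
  · simp [(h.pair i (Finset.mem_univ _)).2.2, dotProduct_sympJ_mulVec_comm (y i) (x i)]
  · simp [h.left_right j (Finset.mem_univ _) i (Finset.mem_univ _) hij.symm, hij,
      dotProduct_sympJ_mulVec_comm (y i)]
  · simp [dotProduct_sympJ_mulVec_self]
  · simp [h.right_right i (Finset.mem_univ _) j (Finset.mem_univ _) hij]

theorem IsSympEigFamily.transpose_mul_mul {A : Matrix (Fin n ⊕ Fin n) (Fin n ⊕ Fin n) ℝ}
    {δ : Fin n → ℝ} {x y : Fin n → Fin n ⊕ Fin n → ℝ}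
    (h : IsSympEigFamily A Finset.univ δ x y) :
    (pairColumns x y)ᵀ * A * pairColumns x y =
      Matrix.fromBlocks (Matrix.diagonal δ) 0 0 (Matrix.diagonal δ) := by
  ext i j
  rw [transpose_mul_mul_pairColumns_apply]
  rcases i with i | i <;> rcases j with j | j <;> obtain ⟨h1, h2, h3⟩ := h.pair j (Finset.mem_univ _)
    <;> rcases eq_or_ne i j with rfl | hij
  · simp [h1, h3]
  · simp [h1, h.left_right i (Finset.mem_univ _) j (Finset.mem_univ _) hij, hij]
  · simp [h2, dotProduct_sympJ_mulVec_self]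
  · simp [h2, h.left_left i (Finset.mem_univ _) j (Finset.mem_univ _) hij]
  · simp [h1, dotProduct_sympJ_mulVec_self]
  · simp [h1, h.right_right i (Finset.mem_univ _) j (Finset.mem_univ _) hij]
  · simp [h2, dotProduct_sympJ_mulVec_comm (y i) (x i), h3]
  · simp [h2, dotProduct_sympJ_mulVec_comm (y i),
      h.left_right j (Finset.mem_univ _) i (Finset.mem_univ _) hij.symm, hij]

theorem IsSympEigFamily.isWilliamsonDiagonal {A : Matrix (Fin n ⊕ Fin n) (Fin n ⊕ Fin n) ℝ}
    (hA : A.PosDef) {δ : Fin n → ℝ} {x y : Fin n → Fin n ⊕ Fin n → ℝ}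
    (h : IsSympEigFamily A Finset.univ δ x y) (hδ : Monotone δ) : IsWilliamsonDiagonal A δ :=
  ⟨hδ, fun j => (h.pair j (Finset.mem_univ _)).pos hA, _, h.isSymplecticMatrix,
    h.transpose_mul_mul⟩

theorem exists_isSympEigFamily_univ {A : Matrix (Fin n ⊕ Fin n) (Fin n ⊕ Fin n) ℝ}
    (hA : A.PosDef) :
    Monotone (sympEig A) ∧ ∃ x y, IsSympEigFamily A Finset.univ (sympEig A) x y := by
  obtain ⟨δ, x, y, h, -⟩ := IsSympEigFamily.exists_univ hA (s := ∅) (δ := 0) (x := 0) (y := 0)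
    ⟨by simp, by simp, by simp, by simp⟩
  have hδ := Tuple.monotone_sort δ
  have h' := h.comp_equiv (Tuple.sort δ)
  have heq := (h'.isWilliamsonDiagonal hA hδ).sympEig_eq
  rw [← heq] at h' hδ
  exact ⟨hδ, _, _, h'⟩

/-- **Williamson's theorem**. -/
theorem isWilliamsonDiagonal_sympEig {A : Matrix (Fin n ⊕ Fin n) (Fin n ⊕ Fin n) ℝ}
    (hA : A.PosDef) : IsWilliamsonDiagonal A (sympEig A) := by
  obtain ⟨hmono, x, y, h⟩ := exists_isSympEigFamily_univ hA
  exact h.isWilliamsonDiagonal hA hmono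

/-- Every normalised symplectic eigenvector pair for `d_m` occurs as the `m`-th pair of columns
of a matrix that brings `A` into Williamson normal form. -/
theorem IsSympEigPair.exists_isSymplecticMatrix
    {A : Matrix (Fin n ⊕ Fin n) (Fin n ⊕ Fin n) ℝ} (hA : A.PosDef) {m : Fin n}
    {x y : Fin n ⊕ Fin n → ℝ} (h : IsSympEigPair A (sympEig A m) x y) :
    ∃ M : Matrix (Fin n ⊕ Fin n) (Fin n ⊕ Fin n) ℝ, IsSymplecticMatrix M ∧
      Mᵀ * A * M = Matrix.fromBlocks (Matrix.diagonal (sympEig A)) 0 0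
        (Matrix.diagonal (sympEig A)) ∧
      M.col (.inl m) = x ∧ M.col (.inr m) = y := by
  obtain ⟨δ, u, v, huv, hm⟩ := IsSympEigFamily.exists_univ hA (s := {m})
    (δ := fun _ => sympEig A m) (x := fun _ => x) (y := fun _ => y)
    ⟨by simpa using h, by simp, by simp, by simp⟩
  obtain ⟨hu, hv⟩ := hm m (by simp)
  have hδm : δ m = sympEig A m := by
    rw [← (huv.pair m (Finset.mem_univ _)).dotProduct_left, ← h.dotProduct_left, hu]
  set σ := Tuple.sort δ
  have hσ : δ ∘ σ = sympEig A :=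
    ((huv.comp_equiv σ).isWilliamsonDiagonal hA (Tuple.monotone_sort δ)).sympEig_eq.symm
  -- Sorting may move the prescribed pair away from position m. Positions m and σ⁻¹(m) carry the
  -- same eigenvalue, so swapping them restores it without disturbing the order.
  set τ := (Equiv.swap m (σ.symm m)).trans σ
  have hτm : τ m = m := by simp [τ]
  have hτ : δ ∘ τ = sympEig A := by
    rw [← hσ]
    funext i
    rcases eq_or_ne i m with rfl | h1
    · simp only [Function.comp_apply, hτm, hδm, ← hσ]
    rcases eq_or_ne i (σ.symm m) with rfl | h2
    · have := congrFun hσ m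
      simp only [Function.comp_apply] at this
      simp [τ, this, hδm]
    · simp [τ, Equiv.swap_apply_of_ne_of_ne h1 h2]
  have hF := huv.comp_equiv τ
  refine ⟨pairColumns (u ∘ τ) (v ∘ τ), hF.isSymplecticMatrix, ?_, ?_, ?_⟩
  · rw [hF.transpose_mul_mul, hτ]
  · ext i
    simp [pairColumns, hτm, hu]
  · ext i
    simp [pairColumns, hτm, hv]

end Williamson

/-! ### Continuity of the eigenvalues and compactness of the eigenvector pairs. -/

section Continuity

open Filter

theorem Matrix.posDef_of_dotProduct_pos {ι : Type*} [Fintype ι] {B : Matrix ι ι ℝ}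
    (hB : B.IsSymm) (h : ∀ x, x ≠ 0 → 0 < x ⬝ᵥ B *ᵥ x) : B.PosDef := by
  rw [Matrix.posDef_iff_dotProduct_mulVec, Matrix.IsHermitian,
    Matrix.conjTranspose_eq_transpose_of_trivial]
  exact ⟨hB, fun x hx => by simpa using h x hx⟩

theorem SymMat.continuous_mulVec {ι : Type*} [Fintype ι] :
    Continuous fun p : SymMat ι × (ι → ℝ) => (p.1 : Matrix ι ι ℝ) *ᵥ p.2 :=
  (continuous_subtype_val.comp continuous_fst).matrix_mulVec continuous_snd

theorem SymMat.eventually_posDef {ι : Type*} [Fintype ι] {A : SymMat ι}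
    (hA : (A : Matrix ι ι ℝ).PosDef) : ∀ᶠ X : SymMat ι in 𝓝 A, (X : Matrix ι ι ℝ).PosDef := by
  have hcont : Continuous fun p : SymMat ι × (ι → ℝ) =>
      p.2 ⬝ᵥ (p.1 : Matrix ι ι ℝ) *ᵥ p.2 :=
    continuous_snd.dotProduct SymMat.continuous_mulVec
  have h := (isCompact_sphere (0 : ι → ℝ) 1).eventually_forall_of_forall_eventually
    (x₀ := A) (P := fun X x => 0 < x ⬝ᵥ (X : Matrix ι ι ℝ) *ᵥ x) fun x hx =>
      (hcont.tendsto (A, x)).eventually (lt_mem_nhds (hA.dotProduct_pos (by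
        rintro rfl
        simp at hx)))
  filter_upwards [h] with X hX
  refine Matrix.posDef_of_dotProduct_pos X.2 fun x hx => ?_
  have h1 := hX (‖x‖⁻¹ • x) (by simp [norm_smul, hx])
  rw [Matrix.mulVec_smul, smul_dotProduct, dotProduct_smul, smul_smul, smul_eq_mul] at h1
  exact pos_of_mul_pos_right h1 (by positivity)

variable {n : ℕ}

/-- Since cA - A is positive definite and positive definiteness is an open condition, cA - X and cX
- A are positive definite for X near A. -/
theorem SymMat.eventually_le_mul {ι : Type*} [Fintype ι] {A : SymMat ι}
    (hA : (A : Matrix ι ι ℝ).PosDef) {c : ℝ} (hc : 1 < c) :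
    ∀ᶠ X : SymMat ι in 𝓝 A,
      (∀ x, x ⬝ᵥ (X : Matrix ι ι ℝ) *ᵥ x ≤ c * (x ⬝ᵥ (A : Matrix ι ι ℝ) *ᵥ x)) ∧
      (∀ x, x ⬝ᵥ (A : Matrix ι ι ℝ) *ᵥ x ≤ c * (x ⬝ᵥ (X : Matrix ι ι ℝ) *ᵥ x)) := by
  have hpos : ((c • A - A : SymMat ι) : Matrix ι ι ℝ).PosDef := by
    refine Matrix.posDef_of_dotProduct_pos (c • A - A : SymMat ι).2 fun x hx => ?_
    have := hA.dotProduct_pos hx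
    simp only [Submodule.coe_sub, Submodule.coe_smul, Matrix.sub_mulVec, Matrix.smul_mulVec,
      dotProduct_sub, dotProduct_smul, smul_eq_mul]
    nlinarith
  have h1 : Tendsto (fun X : SymMat ι => c • A - X) (𝓝 A) (𝓝 (c • A - A)) :=
    (continuous_const.sub continuous_id).tendsto _
  have h2 : Tendsto (fun X : SymMat ι => c • X - A) (𝓝 A) (𝓝 (c • A - A)) :=
    ((continuous_const_smul c).sub continuous_const).tendsto _
  filter_upwards [h1.eventually (SymMat.eventually_posDef hpos),
    h2.eventually (SymMat.eventually_posDef hpos)] with X hX1 hX2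
  refine ⟨fun x => ?_, fun x => ?_⟩
  · have := hX1.dotProduct_nonneg x
    simpa [Matrix.sub_mulVec, Matrix.smul_mulVec] using this
  · have := hX2.dotProduct_nonneg x
    simpa [Matrix.sub_mulVec, Matrix.smul_mulVec] using this

theorem continuousAt_sympEig {A : SymMat (Fin n ⊕ Fin n)}
    (hA : (A : Matrix (Fin n ⊕ Fin n) (Fin n ⊕ Fin n) ℝ).PosDef) (m : Fin n) :
    ContinuousAt (fun X : SymMat (Fin n ⊕ Fin n) =>
      sympEig (X : Matrix (Fin n ⊕ Fin n) (Fin n ⊕ Fin n) ℝ) m) A := by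
  have hAW := isWilliamsonDiagonal_sympEig hA
  refine tendsto_order.2 ⟨fun a ha => ?_, fun a ha => ?_⟩
  · have h1 : ∀ᶠ c : ℝ in 𝓝[>] 1, c * a < sympEig (A : Matrix _ _ ℝ) m :=
      (((continuous_mul_const a).tendsto 1).mono_left nhdsWithin_le_nhds).eventually
        (gt_mem_nhds (by simpa using ha))
    obtain ⟨c, hca, hc⟩ := (h1.and self_mem_nhdsWithin).exists
    have hc0 : (0 : ℝ) < c := zero_lt_one.trans hc
    filter_upwards [SymMat.eventually_le_mul hA hc, SymMat.eventually_posDef hA] with X hX hXp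
    have := (isWilliamsonDiagonal_sympEig hXp).le_mul_of_le hAW hc0.le hX.2 m
    exact lt_of_mul_lt_mul_left (hca.trans_le this) hc0.le
  · have h1 : ∀ᶠ c : ℝ in 𝓝[>] 1, c * sympEig (A : Matrix _ _ ℝ) m < a :=
      (((continuous_mul_const _).tendsto 1).mono_left nhdsWithin_le_nhds).eventually
        (gt_mem_nhds (by simpa using ha))
    obtain ⟨c, hca, hc⟩ := (h1.and self_mem_nhdsWithin).exists
    have hc0 : (0 : ℝ) < c := zero_lt_one.trans hc
    filter_upwards [SymMat.eventually_le_mul hA hc, SymMat.eventually_posDef hA] with X hX hXp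
    exact (hAW.le_mul_of_le (isWilliamsonDiagonal_sympEig hXp) hc0.le hX.1 m).trans_lt hca

theorem norm_le_of_dotProduct_self_le {ι : Type*} [Fintype ι] {x : ι → ℝ} {R : ℝ} (hR : 0 ≤ R)
    (h : x ⬝ᵥ x ≤ R ^ 2) : ‖x‖ ≤ R := by
  refine (pi_norm_le_iff_of_nonneg hR).2 fun i => ?_
  rw [Real.norm_eq_abs]
  refine abs_le_of_sq_le_sq ?_ hR
  refine le_trans ?_ h
  rw [sq]
  exact Finset.single_le_sum (f := fun j => x j * x j) (fun j _ => mul_self_nonneg _)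
    (Finset.mem_univ i)

theorem SymMat.exists_eventually_le {ι : Type*} [Fintype ι] {A : SymMat ι}
    (hA : (A : Matrix ι ι ℝ).PosDef) :
    ∃ ε > 0, ∀ᶠ X : SymMat ι in 𝓝 A, ∀ x, ε * (x ⬝ᵥ x) ≤ x ⬝ᵥ (X : Matrix ι ι ℝ) *ᵥ x := by
  classical
  let I : SymMat ι := ⟨1, Matrix.isSymm_one⟩
  -- Joint continuity in (X, t) at (A, 0) provides one ε that serves all X near A.
  have h1 : Tendsto (fun p : SymMat ι × ℝ => p.1 - p.2 • I) (𝓝 (A, 0)) (𝓝 A) := by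
    have : Continuous fun p : SymMat ι × ℝ => p.1 - p.2 • I :=
      continuous_fst.sub (continuous_snd.smul continuous_const)
    simpa using this.tendsto (A, 0)
  have h2 := h1.eventually (SymMat.eventually_posDef hA)
  rw [nhds_prod_eq] at h2
  obtain ⟨p, hp, q, hq, hpq⟩ := eventually_prod_iff.1 h2
  have hq' : ∀ᶠ t in 𝓝[>] (0 : ℝ), q t := hq.filter_mono nhdsWithin_le_nhds
  obtain ⟨ε, hε, hε0⟩ := (hq'.and self_mem_nhdsWithin).exists
  refine ⟨ε, hε0, hp.mono fun X hX x => ?_⟩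
  have := (hpq hX hε).dotProduct_nonneg x
  simpa [I, Matrix.sub_mulVec, Matrix.smul_mulVec] using this

/-- Normalised symplectic eigenvector pairs of matrices converging to a positive definite matrix
accumulate at normalised symplectic eigenvector pairs of the limit. -/
theorem exists_tendsto_normalisedSympEigPairs {α : Type*} (u : Ultrafilter α)
    {A : SymMat (Fin n ⊕ Fin n)}
    (hA : (A : Matrix (Fin n ⊕ Fin n) (Fin n ⊕ Fin n) ℝ).PosDef) (m : Fin n)
    {Y : α → SymMat (Fin n ⊕ Fin n)} (hY : Tendsto Y u (𝓝 A))
    {z : α → (Fin n ⊕ Fin n → ℝ) × (Fin n ⊕ Fin n → ℝ)}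
    (hz : ∀ᶠ a in (u : Filter α),
      z a ∈ normalisedSympEigPairs (Y a : Matrix (Fin n ⊕ Fin n) (Fin n ⊕ Fin n) ℝ) m) :
    ∃ w ∈ normalisedSympEigPairs (A : Matrix (Fin n ⊕ Fin n) (Fin n ⊕ Fin n) ℝ) m,
      Tendsto z u (𝓝 w) := by
  obtain ⟨ε, hε, hbd⟩ := SymMat.exists_eventually_le hA
  have hd := (continuousAt_sympEig hA m).tendsto.comp hY
  set D := sympEig (A : Matrix (Fin n ⊕ Fin n) (Fin n ⊕ Fin n) ℝ) m with hD
  -- For a normalised pair of Y near A, ε⟨x, x⟩ ≤ ⟨x, Yx⟩ = d_m(Y) < D + 1, and likewise for y.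
  set R := √((D + 1) / ε) with hR
  have hmem : ∀ᶠ a in (u : Filter α), z a ∈ Metric.closedBall
      (0 : (Fin n ⊕ Fin n → ℝ) × (Fin n ⊕ Fin n → ℝ)) R := by
    filter_upwards [hz, hY.eventually hbd, hd.eventually (gt_mem_nhds (lt_add_one D))]
      with a ha hb hc
    have ha' : IsSympEigPair _ _ (z a).1 (z a).2 := ha
    have key : ∀ x : Fin n ⊕ Fin n → ℝ, x ⬝ᵥ (Y a : Matrix _ _ ℝ) *ᵥ x =
        sympEig (Y a : Matrix (Fin n ⊕ Fin n) (Fin n ⊕ Fin n) ℝ) m → ‖x‖ ≤ R := by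
      intro x hx
      have h1 := hb x
      rw [hx] at h1
      have h2 : x ⬝ᵥ x ≤ (D + 1) / ε := by
        rw [le_div_iff₀ hε, mul_comm]
        exact h1.trans hc.le
      refine norm_le_of_dotProduct_self_le (Real.sqrt_nonneg _) ?_
      rwa [Real.sq_sqrt ((Finset.sum_nonneg fun i _ => mul_self_nonneg (x i)).trans h2)]
    rw [mem_closedBall_zero_iff, Prod.norm_def]
    exact max_le (key _ ha'.dotProduct_left) (key _ ha'.dotProduct_right)
  obtain ⟨w, -, hw⟩ := (isCompact_closedBall _ _).ultrafilter_le_nhds (u.map z)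
    (le_principal_iff.2 hmem)
  have hw' : Tendsto z u (𝓝 w) := hw
  have h1 := (continuous_fst.tendsto w).comp hw'
  have h2 := (continuous_snd.tendsto w).comp hw'
  have hJ : Continuous fun v : Fin n ⊕ Fin n → ℝ => sympJ n *ᵥ v := by fun_prop
  have hJ1 := (hJ.tendsto w.1).comp h1
  have hJ2 := (hJ.tendsto w.2).comp h2
  have hY1 := (SymMat.continuous_mulVec.tendsto (A, w.1)).comp (hY.prodMk_nhds h1)
  have hY2 := (SymMat.continuous_mulVec.tendsto (A, w.2)).comp (hY.prodMk_nhds h2)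
  refine ⟨w, ⟨?_, ?_, ?_⟩, hw'⟩
  · exact tendsto_nhds_unique_of_eventuallyEq hY1 (hd.smul hJ2) (hz.mono fun a ha => ha.1)
  · exact tendsto_nhds_unique_of_eventuallyEq hY2 (hd.smul hJ1).neg (hz.mono fun a ha => ha.2.1)
  · have hdot : Continuous fun p : (Fin n ⊕ Fin n → ℝ) × (Fin n ⊕ Fin n → ℝ) =>
        p.1 ⬝ᵥ p.2 := by fun_prop
    exact tendsto_nhds_unique_of_eventuallyEq
      ((hdot.tendsto (w.1, sympJ n *ᵥ w.2)).comp (h1.prodMk_nhds hJ2)) tendsto_const_nhds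
      (hz.mono fun a ha => ha.2.2)

end Continuity

/-! ### Upper bound for the Clarke derivative. -/

section ClarkeBound

open Filter

theorem Filter.Frequently.exists_ultrafilter {α : Type*} {f : Filter α} {p : α → Prop}
    (h : ∃ᶠ x in f, p x) : ∃ u : Ultrafilter α, ↑u ≤ f ∧ ∀ᶠ x in (u : Filter α), p x := by
  have : (f ⊓ 𝓟 {x | p x}).NeBot := frequently_mem_iff_neBot.1 h
  obtain ⟨u, hu⟩ := exists_ultrafilter_le (f ⊓ 𝓟 {x | p x})
  exact ⟨u, hu.trans inf_le_left, le_principal_iff.1 (hu.trans inf_le_right)⟩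

/-- The quadratic form of `B`, summed over a pair of vectors. -/
def pairForm {ι : Type*} [Fintype ι] (B : Matrix ι ι ℝ) (z : (ι → ℝ) × (ι → ℝ)) : ℝ :=
  z.1 ⬝ᵥ B *ᵥ z.1 + z.2 ⬝ᵥ B *ᵥ z.2

theorem continuous_pairForm {ι : Type*} [Fintype ι] (B : Matrix ι ι ℝ) :
    Continuous (pairForm B) := by
  unfold pairForm
  fun_prop

variable {n : ℕ}

theorem normalisedSympEigPairs_nonempty {A : Matrix (Fin n ⊕ Fin n) (Fin n ⊕ Fin n) ℝ}
    (hA : A.PosDef) (m : Fin n) : (normalisedSympEigPairs A m).Nonempty := by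
  obtain ⟨-, x, y, h⟩ := exists_isSympEigFamily_univ hA
  exact ⟨(x m, y m), h.pair m (Finset.mem_univ _)⟩

/-- Upper semicontinuity of the set of pairs: violating pairs of matrices tending to A would
accumulate at a violating pair of A. -/
theorem eventually_forall_normalisedSympEigPairs {A : SymMat (Fin n ⊕ Fin n)}
    (hA : (A : Matrix (Fin n ⊕ Fin n) (Fin n ⊕ Fin n) ℝ).PosDef) (m : Fin n)
    (H : SymMat (Fin n ⊕ Fin n)) {c : ℝ}
    (hc : ∀ z ∈ normalisedSympEigPairs (A : Matrix (Fin n ⊕ Fin n) (Fin n ⊕ Fin n) ℝ) m,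
      c < pairForm (H : Matrix (Fin n ⊕ Fin n) (Fin n ⊕ Fin n) ℝ) z) :
    ∀ᶠ Y : SymMat (Fin n ⊕ Fin n) in 𝓝 A,
      ∀ z ∈ normalisedSympEigPairs (Y : Matrix (Fin n ⊕ Fin n) (Fin n ⊕ Fin n) ℝ) m,
      c < pairForm (H : Matrix (Fin n ⊕ Fin n) (Fin n ⊕ Fin n) ℝ) z := by
  by_contra hcon
  obtain ⟨u, hu, hbad⟩ := (not_eventually.1 hcon).exists_ultrafilter
  push Not at hbad
  obtain ⟨z, hz⟩ := hbad.choice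
  obtain ⟨w, hw, hzw⟩ := exists_tendsto_normalisedSympEigPairs u hA m (Y := id) hu
    (hz.mono fun a ha => ha.1)
  have hlim := ((continuous_pairForm (H : Matrix (Fin n ⊕ Fin n) (Fin n ⊕ Fin n) ℝ)).tendsto
    w).comp hzw
  exact (hc w hw).not_ge (le_of_tendsto hlim (hz.mono fun a ha => ha.2))

/-- The equations of the perturbed pair are tested against the unperturbed one, and `A` is moved
across by symmetry. The identity is exact, with no differentiability of the eigenvalues; as (u, v) →
(x, y) the last bracket tends to 2, the source of the factor ½. -/
theorem IsSympEigPair.perturbation_identity {A H : Matrix (Fin n ⊕ Fin n) (Fin n ⊕ Fin n) ℝ}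
    (hA : A.IsSymm) {s d e : ℝ} {x y u v : Fin n ⊕ Fin n → ℝ}
    (h : IsSympEigPair A d x y) (h' : IsSympEigPair (A + s • H) e u v) :
    s * (x ⬝ᵥ H *ᵥ u + y ⬝ᵥ H *ᵥ v) =
      (e - d) * (x ⬝ᵥ sympJ n *ᵥ v - y ⬝ᵥ sympJ n *ᵥ u) := by
  have h1 := congrArg (x ⬝ᵥ ·) h'.1
  have h2 := congrArg (y ⬝ᵥ ·) h'.2.1
  simp only [Matrix.add_mulVec, Matrix.smul_mulVec, dotProduct_add, dotProduct_smul,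
    dotProduct_neg, smul_eq_mul] at h1 h2
  rw [dotProduct_mulVec_comm hA, h.1] at h1
  rw [dotProduct_mulVec_comm hA, h.2.1] at h2
  rw [dotProduct_smul, dotProduct_sympJ_mulVec_comm, smul_eq_mul] at h1
  rw [dotProduct_neg, dotProduct_smul, dotProduct_sympJ_mulVec_comm, smul_eq_mul] at h2
  linarith

/-- Every right cluster value of the difference quotients of `d_m` along a line is
`½ (⟨x, H x⟩ + ⟨y, H y⟩)` for a normalised eigenvector pair `(x, y)`. -/
theorem eventually_lt_sympEig_sub {A : SymMat (Fin n ⊕ Fin n)}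
    (hA : (A : Matrix (Fin n ⊕ Fin n) (Fin n ⊕ Fin n) ℝ).PosDef) (m : Fin n)
    (H : SymMat (Fin n ⊕ Fin n)) {c : ℝ}
    (hc : ∀ z ∈ normalisedSympEigPairs (A : Matrix (Fin n ⊕ Fin n) (Fin n ⊕ Fin n) ℝ) m,
      2 * c < pairForm (H : Matrix (Fin n ⊕ Fin n) (Fin n ⊕ Fin n) ℝ) z) :
    ∀ᶠ s in 𝓝[>] (0 : ℝ),
      c * s < sympEig ((A + s • H : SymMat _) : Matrix (Fin n ⊕ Fin n) (Fin n ⊕ Fin n) ℝ) m -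
        sympEig (A : Matrix (Fin n ⊕ Fin n) (Fin n ⊕ Fin n) ℝ) m := by
  by_contra hcon
  obtain ⟨u, hu, hbad⟩ := (not_eventually.1 hcon).exists_ultrafilter
  have hs0 : Tendsto (fun s : ℝ => s) u (𝓝 0) := hu.trans nhdsWithin_le_nhds
  have hspos : ∀ᶠ s in (u : Filter ℝ), 0 < s := hu self_mem_nhdsWithin
  have hY : Tendsto (fun s : ℝ => A + s • H) u (𝓝 A) := by
    have : Continuous fun s : ℝ => A + s • H := by fun_prop
    exact (this.tendsto' 0 A (by simp)).comp hs0
  obtain ⟨z, hz⟩ := ((hY.eventually (SymMat.eventually_posDef hA)).mono fun s hs =>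
    (normalisedSympEigPairs_nonempty hs m : ∃ z, z ∈ _)).choice
  obtain ⟨w, hw, hzw⟩ := exists_tendsto_normalisedSympEigPairs u hA m hY hz
  have hw' : IsSympEigPair _ _ w.1 w.2 := hw
  let p : (Fin n ⊕ Fin n → ℝ) × (Fin n ⊕ Fin n → ℝ) → ℝ := fun z =>
    w.1 ⬝ᵥ (H : Matrix (Fin n ⊕ Fin n) (Fin n ⊕ Fin n) ℝ) *ᵥ z.1 +
      w.2 ⬝ᵥ (H : Matrix (Fin n ⊕ Fin n) (Fin n ⊕ Fin n) ℝ) *ᵥ z.2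
  let q : (Fin n ⊕ Fin n → ℝ) × (Fin n ⊕ Fin n → ℝ) → ℝ := fun z =>
    w.1 ⬝ᵥ sympJ n *ᵥ z.2 - w.2 ⬝ᵥ sympJ n *ᵥ z.1
  have hp : Continuous p := by fun_prop
  have hq : Continuous q := by fun_prop
  have hqw : q w = 2 := by
    simp only [q, dotProduct_sympJ_mulVec_comm w.2 w.1, hw'.2.2]
    norm_num
  have hplim := (hp.tendsto w).comp hzw
  have hqlim := (hq.tendsto w).comp hzw
  have hle : p w ≤ c * q w := by
    refine le_of_tendsto_of_tendsto hplim (hqlim.const_mul c) ?_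
    have hq0 : ∀ᶠ s in (u : Filter ℝ), 0 < q (z s) :=
      hqlim.eventually (lt_mem_nhds (by rw [hqw]; norm_num))
    filter_upwards [hbad, hspos, hz, hq0] with s hsb hs hzs hqs
    have hid : s * p (z s) = _ * q (z s) := hw'.perturbation_identity A.2 hzs
    have h1 : s * p (z s) ≤ s * (c * q (z s)) := by
      rw [hid, ← mul_assoc, mul_comm s c]
      exact mul_le_mul_of_nonneg_right (not_lt.1 hsb) hqs.le
    exact le_of_mul_le_mul_left h1 hs
  have h2 := hc w hw
  rw [hqw] at hle
  have h3 : p w = pairForm (H : Matrix (Fin n ⊕ Fin n) (Fin n ⊕ Fin n) ℝ) w := rfl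
  linarith

/-- A mean value inequality for a merely continuous function: at each point of the segment its right
difference quotients are controlled through the pairs there, and this suffices to compare -d_m with
a line of slope -c. -/
theorem mul_le_sympEig_sub {X H : SymMat (Fin n ⊕ Fin n)} {t c : ℝ} (ht : 0 ≤ t) (m : Fin n)
    (hpos : ∀ s ∈ Set.Icc 0 t,
      ((X + s • H : SymMat _) : Matrix (Fin n ⊕ Fin n) (Fin n ⊕ Fin n) ℝ).PosDef)
    (hc : ∀ s ∈ Set.Icc 0 t, ∀ z ∈ normalisedSympEigPairs
      ((X + s • H : SymMat _) : Matrix (Fin n ⊕ Fin n) (Fin n ⊕ Fin n) ℝ) m,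
      2 * c < pairForm (H : Matrix (Fin n ⊕ Fin n) (Fin n ⊕ Fin n) ℝ) z) :
    c * t ≤ sympEig ((X + t • H : SymMat _) : Matrix (Fin n ⊕ Fin n) (Fin n ⊕ Fin n) ℝ) m -
      sympEig (X : Matrix (Fin n ⊕ Fin n) (Fin n ⊕ Fin n) ℝ) m := by
  let φ : ℝ → ℝ := fun s =>
    -sympEig ((X + s • H : SymMat _) : Matrix (Fin n ⊕ Fin n) (Fin n ⊕ Fin n) ℝ) m
  have hline : Continuous fun s : ℝ => X + s • H := by fun_prop
  have hcont : ContinuousOn φ (Set.Icc 0 t) := fun s hs =>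
    ((continuousAt_sympEig (hpos s hs) m).comp (f := fun s : ℝ => X + s • H)
      hline.continuousAt).neg.continuousWithinAt
  have h0 : φ 0 = -sympEig (X : Matrix (Fin n ⊕ Fin n) (Fin n ⊕ Fin n) ℝ) m := by
    simp only [φ, zero_smul, add_zero]
  have key := image_le_of_liminf_slope_right_le_deriv_boundary hcont
    (B := fun s => φ 0 + -c * s) (B' := fun _ => -c) (by simp) (by fun_prop)
    (fun s _ => by
      simpa using (((hasDerivAt_id s).const_mul (-c)).const_add (φ 0)).hasDerivWithinAt)
    (fun s hs r hr => by
      have hs' := Set.Ico_subset_Icc_self hs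
      have h1 := eventually_lt_sympEig_sub (hpos s hs') m H (hc s hs')
      have h2 : Tendsto (fun v : ℝ => v - s) (𝓝[>] s) (𝓝[>] 0) := by
        refine tendsto_nhdsWithin_iff.2 ⟨?_, ?_⟩
        · have : Continuous fun v : ℝ => v - s := by fun_prop
          have := (this.tendsto s).mono_left (nhdsWithin_le_nhds (s := Set.Ioi s))
          rwa [sub_self] at this
        · filter_upwards [self_mem_nhdsWithin] with v hv
          exact sub_pos.2 (Set.mem_Ioi.1 hv)
      refine ((h2.eventually h1).and self_mem_nhdsWithin).frequently.mono ?_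
      rintro v ⟨hv, hsv⟩
      have hvs : 0 < v - s := sub_pos.2 hsv
      rw [add_assoc, ← add_smul, add_sub_cancel] at hv
      rw [slope_def_field]
      refine lt_trans ?_ hr
      rw [div_lt_iff₀ hvs]
      simp only [φ]
      linarith) (Set.right_mem_Icc.2 ht)
  rw [h0] at key
  simp only [φ] at key
  linarith

theorem negSympEig_of_posDef {X : SymMat (Fin n ⊕ Fin n)}
    (hX : (X : Matrix (Fin n ⊕ Fin n) (Fin n ⊕ Fin n) ℝ).PosDef) (m : Fin n) :
    negSympEig m X =
      ((-(sympEig (X : Matrix (Fin n ⊕ Fin n) (Fin n ⊕ Fin n) ℝ) m) : ℝ) : EReal) :=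
  if_pos hX

theorem clarkeDeriv_negSympEig_le {A : SymMat (Fin n ⊕ Fin n)}
    (hA : (A : Matrix (Fin n ⊕ Fin n) (Fin n ⊕ Fin n) ℝ).PosDef) (m : Fin n)
    (H : SymMat (Fin n ⊕ Fin n)) {c : ℝ}
    (hc : ∀ z ∈ normalisedSympEigPairs (A : Matrix (Fin n ⊕ Fin n) (Fin n ⊕ Fin n) ℝ) m,
      -(1 / 2) * pairForm (H : Matrix (Fin n ⊕ Fin n) (Fin n ⊕ Fin n) ℝ) z < c) :
    SymMat.clarkeDeriv (negSympEig m) A H ≤ c := by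
  refine limsup_le_of_le (by isBoundedDefault) ?_
  have h1 := (SymMat.eventually_posDef hA).and
    (eventually_forall_normalisedSympEigPairs hA m H (c := 2 * -c) fun z hz => by
      linarith [hc z hz])
  have hcont : Continuous fun p : SymMat (Fin n ⊕ Fin n) × ℝ => p.1 + p.2 • H := by fun_prop
  -- A product neighbourhood of (A, 0) is needed so that the whole segment X + sH, 0 ≤ s ≤ t, stays
  -- in the good region.
  have h2 := (hcont.tendsto' (A, 0) A (by simp)).eventually h1
  rw [nhds_prod_eq] at h2
  obtain ⟨U, hU, V, hV, hUV⟩ := eventually_prod_iff.1 h2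
  obtain ⟨δ, hδ, hδV⟩ := Metric.eventually_nhds_iff.1 hV
  have h3 : ∀ᶠ t in 𝓝[>] (0 : ℝ), t ∈ Set.Ioo 0 δ := Ioo_mem_nhdsGT hδ
  filter_upwards [hU.prod_mk h3] with ⟨X, t⟩ ⟨hX, ht⟩
  have hseg : ∀ s ∈ Set.Icc 0 t, V s := fun s hs => hδV (by
    rw [Real.dist_eq, sub_zero, abs_of_nonneg hs.1]
    exact hs.2.trans_lt ht.2)
  have hpos := fun s hs => (hUV hX (hseg s hs)).1
  have key := mul_le_sympEig_sub ht.1.le m hpos fun s hs => (hUV hX (hseg s hs)).2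
  have hX0 : (X : Matrix (Fin n ⊕ Fin n) (Fin n ⊕ Fin n) ℝ).PosDef := by
    simpa using hpos 0 (Set.left_mem_Icc.2 ht.1.le)
  dsimp only at hX ⊢
  rw [negSympEig_of_posDef hX0, negSympEig_of_posDef (hpos t (Set.right_mem_Icc.2 ht.1.le)),
    ← EReal.coe_sub, ← EReal.coe_div, EReal.coe_le_coe_iff, div_le_iff₀ ht.1]
  linarith

end ClarkeBound

/-! ### Lower bound for the Michel-Penot derivative. -/

section MichelPenotBound

open Filter

theorem exists_dotProduct_mulVec_self_le {ι : Type*} [Fintype ι] (G : Matrix ι ι ℝ) :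
    ∃ C, 0 ≤ C ∧ ∀ h, h ⬝ᵥ G *ᵥ h ≤ C * (h ⬝ᵥ h) := by
  refine ⟨∑ i, ∑ j, |G i j|, by positivity, fun h => ?_⟩
  have hsq : ∀ i, h i ^ 2 ≤ h ⬝ᵥ h := fun i => by
    rw [sq]
    exact Finset.single_le_sum (f := fun j => h j * h j) (fun j _ => mul_self_nonneg _)
      (Finset.mem_univ i)
  have hle : ∀ i j, h i * (G i j * h j) ≤ |G i j| * (h ⬝ᵥ h) := fun i j => by
    have h1 : |h i * h j| ≤ h ⬝ᵥ h := by
      rw [abs_le]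
      constructor <;> nlinarith [hsq i, hsq j, sq_nonneg (h i + h j), sq_nonneg (h i - h j)]
    calc h i * (G i j * h j) = G i j * (h i * h j) := by ring
      _ ≤ |G i j| * |h i * h j| := by rw [← abs_mul]; exact le_abs_self _
      _ ≤ _ := mul_le_mul_of_nonneg_left h1 (abs_nonneg _)
  rw [Finset.sum_mul]
  refine Finset.sum_le_sum fun i _ => ?_
  rw [Finset.sum_mul, Matrix.mulVec, dotProduct, Finset.mul_sum]
  exact Finset.sum_le_sum fun j _ => hle i j

/-- Young's inequality with weight ε on the cross term 2⟨g, Gh⟩: the cost on g is arbitrarily small,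
at the price of a large constant on h. -/
theorem exists_dotProduct_mulVec_add_le {ι : Type*} [Fintype ι] {G : Matrix ι ι ℝ}
    (hG : G.IsSymm) {ε : ℝ} (hε : 0 < ε) :
    ∃ C, 0 ≤ C ∧ ∀ g h, (g + h) ⬝ᵥ G *ᵥ (g + h) ≤ g ⬝ᵥ G *ᵥ g + ε * (g ⬝ᵥ g) + C * (h ⬝ᵥ h) := by
  obtain ⟨C, hC, hCh⟩ := exists_dotProduct_mulVec_self_le G
  obtain ⟨D, hD, hDh⟩ := exists_dotProduct_mulVec_self_le (Gᵀ * G)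
  refine ⟨ε⁻¹ * D + C, by positivity, fun g h => ?_⟩
  have h1 : (G *ᵥ h) ⬝ᵥ (G *ᵥ h) ≤ D * (h ⬝ᵥ h) := by
    have := hDh h
    rwa [← Matrix.mulVec_mulVec, Matrix.dotProduct_mulVec, Matrix.vecMul_transpose] at this
  have h2 : 2 * (g ⬝ᵥ G *ᵥ h) ≤ ε * (g ⬝ᵥ g) + ε⁻¹ * ((G *ᵥ h) ⬝ᵥ (G *ᵥ h)) := by
    simp only [dotProduct, Finset.mul_sum, ← Finset.sum_add_distrib]
    refine Finset.sum_le_sum fun i _ => ?_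
    have h3 : 0 ≤ ε⁻¹ * (ε * g i - (G *ᵥ h) i) ^ 2 := by positivity
    have h4 : ε⁻¹ * (ε * g i - (G *ᵥ h) i) ^ 2 = ε * (g i * g i) +
        ε⁻¹ * ((G *ᵥ h) i * (G *ᵥ h) i) - 2 * (g i * (G *ᵥ h) i) := by
      field_simp
      ring
    linarith
  have h5 := mul_le_mul_of_nonneg_left h1 (inv_pos.2 hε).le
  simp only [Matrix.mulVec_add, add_dotProduct, dotProduct_add, dotProduct_mulVec_comm hG h g]
  linarith [hCh h]

variable {n : ℕ}

/-- On pairs with complex coordinates `p - i q`, a symmetric form is bounded by its value on the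
`m`-th coordinate pair up to an arbitrarily small error and a multiple of the remaining
coordinates. -/
theorem exists_coordinate_pair_le {G : Matrix (Fin n ⊕ Fin n) (Fin n ⊕ Fin n) ℝ}
    (hG : G.IsSymm) (m : Fin n) {ε : ℝ} (hε : 0 < ε) :
    ∃ C, 0 ≤ C ∧ ∀ p q : Fin n → ℝ, p m ^ 2 + q m ^ 2 ≤ ∑ j, (p j ^ 2 + q j ^ 2) ∧
      Sum.elim p q ⬝ᵥ G *ᵥ Sum.elim p q + Sum.elim (-q) p ⬝ᵥ G *ᵥ Sum.elim (-q) p ≤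
        (p m ^ 2 + q m ^ 2) * (G (.inl m) (.inl m) + G (.inr m) (.inr m) + 2 * ε) +
        2 * C * (∑ j, (p j ^ 2 + q j ^ 2) - (p m ^ 2 + q m ^ 2)) := by
  obtain ⟨C, hC, hCgh⟩ := exists_dotProduct_mulVec_add_le hG hε
  refine ⟨C, hC, fun p q => ?_⟩
  let g : (Fin n → ℝ) → (Fin n → ℝ) → Fin n ⊕ Fin n → ℝ := fun p q =>
    p m • Pi.single (.inl m) 1 + q m • Pi.single (.inr m) 1
  have hgg : ∀ p q, g p q ⬝ᵥ g p q = p m ^ 2 + q m ^ 2 := fun p q => by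
    simp [g]
    ring
  have hgG : ∀ p q, g p q ⬝ᵥ G *ᵥ g p q = p m ^ 2 * G (.inl m) (.inl m) +
      q m ^ 2 * G (.inr m) (.inr m) + 2 * (p m * q m) * G (.inl m) (.inr m) := fun p q => by
    have := hG.apply (.inl m) (.inr m)
    simp [g, Matrix.mulVec_add, Matrix.mulVec_smul, this]
    ring
  have hhh : ∀ p q, (Sum.elim p q - g p q) ⬝ᵥ (Sum.elim p q - g p q) =
      ∑ j, (p j ^ 2 + q j ^ 2) - (p m ^ 2 + q m ^ 2) := fun p q => by
    have h1 : Sum.elim p q ⬝ᵥ g p q = p m ^ 2 + q m ^ 2 := by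
      simp [g]
      ring
    have h2 : Sum.elim p q ⬝ᵥ Sum.elim p q = ∑ j, (p j ^ 2 + q j ^ 2) := by
      simp only [dotProduct, Fintype.sum_sum_type, Sum.elim_inl, Sum.elim_inr,
        ← Finset.sum_add_distrib, sq]
    rw [sub_dotProduct, dotProduct_sub, dotProduct_sub, dotProduct_comm (g p q), hgg, h1, h2]
    ring
  have key : ∀ p q, Sum.elim p q ⬝ᵥ G *ᵥ Sum.elim p q ≤ g p q ⬝ᵥ G *ᵥ g p q +
      ε * (p m ^ 2 + q m ^ 2) + C * (∑ j, (p j ^ 2 + q j ^ 2) - (p m ^ 2 + q m ^ 2)) :=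
    fun p q => by
      have := hCgh (g p q) (Sum.elim p q - g p q)
      rwa [add_sub_cancel, hgg, hhh] at this
  constructor
  · have h1 : 0 ≤ (Sum.elim p q - g p q) ⬝ᵥ (Sum.elim p q - g p q) :=
      Finset.sum_nonneg fun i _ => mul_self_nonneg _
    rw [hhh] at h1
    linarith
  · have h1 := key p q
    have h2 := key (-q) p
    have h3 : ∑ j, ((-q) j ^ 2 + p j ^ 2) = ∑ j, (p j ^ 2 + q j ^ 2) :=
      Finset.sum_congr rfl fun j _ => by rw [Pi.neg_apply]; ring
    rw [h3, hgG, Pi.neg_apply] at h2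
    rw [hgG] at h1
    linarith

/-- A direction that separates the `m`-th pair of columns of `M` from the preceding ones. -/
theorem exists_separating_direction {M : Matrix (Fin n ⊕ Fin n) (Fin n ⊕ Fin n) ℝ}
    (hM : IsSymplecticMatrix M) (c : Fin n → ℝ) :
    ∃ X : SymMat (Fin n ⊕ Fin n), Mᵀ * (X : Matrix (Fin n ⊕ Fin n) (Fin n ⊕ Fin n) ℝ) * M =
      Matrix.fromBlocks (Matrix.diagonal c) 0 0 (Matrix.diagonal c) := by
  obtain ⟨N, hN⟩ := hM.exists_mul_eq_one
  have hN' : N * M = 1 := mul_eq_one_comm.1 hN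
  have hNt : Mᵀ * Nᵀ = 1 := by rw [← Matrix.transpose_mul, hN', Matrix.transpose_one]
  refine ⟨⟨Nᵀ * Matrix.fromBlocks (Matrix.diagonal c) 0 0 (Matrix.diagonal c) * N, ?_⟩, ?_⟩
  · change Matrix.IsSymm _
    rw [Matrix.IsSymm, Matrix.transpose_mul, Matrix.transpose_mul, Matrix.transpose_transpose,
      Matrix.fromBlocks_transpose]
    simp [Matrix.mul_assoc]
  · simp only [Matrix.mul_assoc, hN', Matrix.mul_one]
    rw [← Matrix.mul_assoc, hNt, Matrix.one_mul]

/-- Raising the levels from m on by tl turns d_m into d_m + tl. In the span of the column pairs up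
to m, the components below m miss this gain, and for large l the deficit absorbs both their own
H-form and their coupling with the m-th pair, even if d_m(A) is multiple. -/
theorem exists_eventually_sympEig_sub_le {A : SymMat (Fin n ⊕ Fin n)}
    (hA : (A : Matrix (Fin n ⊕ Fin n) (Fin n ⊕ Fin n) ℝ).PosDef) (m : Fin n)
    (H : SymMat (Fin n ⊕ Fin n)) {z : (Fin n ⊕ Fin n → ℝ) × (Fin n ⊕ Fin n → ℝ)}
    (hz : z ∈ normalisedSympEigPairs (A : Matrix (Fin n ⊕ Fin n) (Fin n ⊕ Fin n) ℝ) m)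
    {ε : ℝ} (hε : 0 < ε) :
    ∃ X : SymMat (Fin n ⊕ Fin n), ∀ᶠ t in 𝓝[>] (0 : ℝ),
      ((A + t • X : SymMat _) : Matrix (Fin n ⊕ Fin n) (Fin n ⊕ Fin n) ℝ).PosDef ∧
      ((A + t • X + t • H : SymMat _) : Matrix (Fin n ⊕ Fin n) (Fin n ⊕ Fin n) ℝ).PosDef ∧
      sympEig ((A + t • X + t • H : SymMat _) : Matrix (Fin n ⊕ Fin n) (Fin n ⊕ Fin n) ℝ) m -
        sympEig ((A + t • X : SymMat _) : Matrix (Fin n ⊕ Fin n) (Fin n ⊕ Fin n) ℝ) m ≤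
        t * (1 / 2 * pairForm (H : Matrix (Fin n ⊕ Fin n) (Fin n ⊕ Fin n) ℝ) z + ε) := by
  obtain ⟨M, hM, hAM, hx, hy⟩ := IsSympEigPair.exists_isSymplecticMatrix hA hz
  -- Levels above m are raised as well, so the shifted list stays sorted and m keeps its position.
  let χ : Fin n → ℝ := fun j => if j < m then 0 else 1
  obtain ⟨X₀, hX₀⟩ := exists_separating_direction hM χ
  set G := Mᵀ * (H : Matrix (Fin n ⊕ Fin n) (Fin n ⊕ Fin n) ℝ) * M with hGdef
  have hH : (H : Matrix (Fin n ⊕ Fin n) (Fin n ⊕ Fin n) ℝ).IsSymm := H.2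
  have hG : G.IsSymm := by
    rw [Matrix.IsSymm, hGdef, Matrix.transpose_mul, Matrix.transpose_mul,
      Matrix.transpose_transpose, hH.eq, Matrix.mul_assoc]
  obtain ⟨C, hC, hCpq⟩ := exists_coordinate_pair_le hG m hε
  have hGdiag : ∀ i, G i i =
      M.col i ⬝ᵥ (H : Matrix (Fin n ⊕ Fin n) (Fin n ⊕ Fin n) ℝ) *ᵥ M.col i := fun i => by
    rw [← Matrix.mulVec_single_one M i, mulVec_dotProduct_mulVec_mulVec, ← hGdef,
      Matrix.mulVec_single_one, single_one_dotProduct]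
    rfl
  set Q := pairForm (H : Matrix (Fin n ⊕ Fin n) (Fin n ⊕ Fin n) ℝ) z with hQdef
  have hQ : G (.inl m) (.inl m) + G (.inr m) (.inr m) = Q := by
    rw [hGdiag, hGdiag, hx, hy, hQdef, pairForm]
  -- C pays for the error term of `exists_coordinate_pair_le`. The summand |Q| pays for a negative
  -- Q, because the target ½Q + ε multiplies the full sum over j and not only the m-th coordinates.
  set l := C + |Q| with hl
  have hl0 : 0 ≤ l := by positivity
  have hlin : ∀ K : SymMat (Fin n ⊕ Fin n), ∀ᶠ t in 𝓝[>] (0 : ℝ),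
      ((A + t • K : SymMat _) : Matrix (Fin n ⊕ Fin n) (Fin n ⊕ Fin n) ℝ).PosDef := fun K => by
    have hc : Continuous fun t : ℝ => A + t • K := by fun_prop
    exact ((hc.tendsto' 0 A (by simp)).mono_left nhdsWithin_le_nhds).eventually
      (SymMat.eventually_posDef hA)
  refine ⟨l • X₀, ?_⟩
  filter_upwards [hlin (l • X₀), hlin (l • X₀ + H), self_mem_nhdsWithin] with t h1 h2 ht
  have ht : 0 < t := ht
  rw [smul_add, ← add_assoc] at h2
  refine ⟨h1, h2, ?_⟩
  set d := sympEig (A : Matrix (Fin n ⊕ Fin n) (Fin n ⊕ Fin n) ℝ) with hd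
  obtain ⟨hmono, hdpos, -⟩ := isWilliamsonDiagonal_sympEig hA
  have htl : 0 ≤ t * l := mul_nonneg ht.le hl0
  have hdiag : Mᵀ * ((A + t • l • X₀ : SymMat _) : Matrix (Fin n ⊕ Fin n) (Fin n ⊕ Fin n) ℝ) * M =
      Matrix.fromBlocks (Matrix.diagonal (fun j => d j + t * l * χ j)) 0 0
        (Matrix.diagonal (fun j => d j + t * l * χ j)) := by
    have h3 : (Matrix.diagonal (fun j => d j + t * l * χ j)) =
        Matrix.diagonal d + (t * l) • Matrix.diagonal χ := by
      rw [← Matrix.diagonal_smul, Matrix.diagonal_add]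
      rfl
    rw [smul_smul, Submodule.coe_add, Submodule.coe_smul, Matrix.mul_add, Matrix.add_mul, hAM,
      Matrix.mul_smul, Matrix.smul_mul, hX₀, Matrix.fromBlocks_smul, Matrix.fromBlocks_add, h3]
    simp
  have hχ : Monotone χ := fun i j hij => by
    by_cases hj : j < m
    · simp [χ, hj, hij.trans_lt hj]
    · simp only [χ, hj, if_false]
      split_ifs <;> norm_num
  have hχ0 : ∀ j, 0 ≤ χ j := fun j => by
    simp only [χ]
    split_ifs <;> norm_num
  have hW : IsWilliamsonDiagonal
      ((A + t • l • X₀ : SymMat _) : Matrix (Fin n ⊕ Fin n) (Fin n ⊕ Fin n) ℝ)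
      (fun j => d j + t * l * χ j) :=
    ⟨fun i j hij => add_le_add (hmono hij) (mul_le_mul_of_nonneg_left (hχ hij) htl),
      fun j => add_pos_of_pos_of_nonneg (hdpos j) (mul_nonneg htl (hχ0 j)), M, hM, hdiag⟩
  have heq : sympEig ((A + t • l • X₀ : SymMat _) : Matrix (Fin n ⊕ Fin n) (Fin n ⊕ Fin n) ℝ) m =
      d m + t * l := by
    rw [hW.sympEig_eq]
    simp [χ]
  have hle := (isWilliamsonDiagonal_sympEig h2).le_of_forall_trial hM m
    (c := d m + t * l + t * (1 / 2 * Q + ε)) fun p q hpq => by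
      obtain ⟨ha, hb⟩ := hCpq p q
      rw [hQ] at hb
      have h3 := coordinate_pair_forms hdiag p q
      have h4 : ∑ j, (d j + t * l * χ j) * (p j ^ 2 + q j ^ 2) ≤
          d m * ∑ j, (p j ^ 2 + q j ^ 2) + t * l * (p m ^ 2 + q m ^ 2) := by
        simp only [add_mul, Finset.sum_add_distrib]
        refine add_le_add ?_ (le_of_eq ?_)
        · rw [← Finset.sum_add_distrib, Finset.mul_sum]
          refine Finset.sum_le_sum fun j _ => ?_
          rcases le_or_gt j m with hj | hj
          · exact mul_le_mul_of_nonneg_right (hmono hj) (by positivity)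
          · simp [hpq j hj]
        · rw [Finset.sum_eq_single m]
          · simp [χ]
          · intro j _ hj
            rcases hj.lt_or_gt with hj | hj
            · simp [χ, hj]
            · simp [hpq j hj]
          · simp
      rw [Submodule.coe_add (A + t • l • X₀), Submodule.coe_smul]
      simp only [Matrix.add_mulVec, dotProduct_add, Matrix.smul_mulVec, dotProduct_smul,
        smul_eq_mul, mulVec_dotProduct_mulVec_mulVec M
          (H : Matrix (Fin n ⊕ Fin n) (Fin n ⊕ Fin n) ℝ), ← hGdef] at h3 ⊢
      set S := ∑ j, (p j ^ 2 + q j ^ 2)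
      have h5 : 0 ≤ (S - (p m ^ 2 + q m ^ 2)) * (2 * l + Q + 2 * ε - 2 * C) := by
        refine mul_nonneg (sub_nonneg.2 ha) ?_
        linarith [neg_abs_le Q, abs_nonneg Q]
      have h6 := mul_le_mul_of_nonneg_left hb ht.le
      have h7 := mul_nonneg ht.le h5
      linarith
  rw [heq]
  linarith

theorem le_michelPenotDeriv_negSympEig {A : SymMat (Fin n ⊕ Fin n)}
    (hA : (A : Matrix (Fin n ⊕ Fin n) (Fin n ⊕ Fin n) ℝ).PosDef) (m : Fin n)
    (H : SymMat (Fin n ⊕ Fin n)) {z : (Fin n ⊕ Fin n → ℝ) × (Fin n ⊕ Fin n → ℝ)}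
    (hz : z ∈ normalisedSympEigPairs (A : Matrix (Fin n ⊕ Fin n) (Fin n ⊕ Fin n) ℝ) m) :
    ((-(1 / 2) * pairForm (H : Matrix (Fin n ⊕ Fin n) (Fin n ⊕ Fin n) ℝ) z : ℝ) : EReal) ≤
      SymMat.michelPenotDeriv (negSympEig m) A H := by
  refine EReal.ge_of_forall_gt_iff_ge.1 fun r hr => ?_
  rw [EReal.coe_lt_coe_iff] at hr
  obtain ⟨X, hX⟩ := exists_eventually_sympEig_sub_le hA m H hz (sub_pos.2 hr)
  refine le_iSup_of_le X (le_limsup_of_frequently_le (Eventually.frequently ?_)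
    (by isBoundedDefault))
  filter_upwards [hX, self_mem_nhdsWithin] with t ⟨h1, h2, h3⟩ ht
  have ht : 0 < t := ht
  rw [negSympEig_of_posDef h1, negSympEig_of_posDef h2, ← EReal.coe_sub, ← EReal.coe_div,
    EReal.coe_le_coe_iff, le_div_iff₀ ht]
  linarith

end MichelPenotBound

/-! ### From directional derivatives to subdifferentials by duality. -/

section Subdifferential

open Filter

namespace SymMat

theorem michelPenotDeriv_le_clarkeDeriv {ι : Type*} (f : SymMat ι → EReal) (A H : SymMat ι) :
    michelPenotDeriv f A H ≤ clarkeDeriv f A H := by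
  refine iSup_le fun X => ?_
  have hc : Continuous fun t : ℝ => A + t • X := by fun_prop
  have h : Tendsto (fun t : ℝ => (A + t • X, t)) (𝓝[>] 0) (𝓝 A ×ˢ 𝓝[>] (0 : ℝ)) :=
    ((hc.tendsto' 0 A (by simp)).mono_left nhdsWithin_le_nhds).prodMk tendsto_id
  exact limsup_le_limsup_of_le (f := map (fun t : ℝ => (A + t • X, t)) (𝓝[>] 0)) h
    (u := fun p : SymMat ι × ℝ => (f (p.1 + p.2 • H) - f p.1) / (p.2 : EReal))

variable {ι : Type*} [Fintype ι]

instance : LocallyConvexSpace ℝ (SymMat ι) :=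
  have : LocallyConvexSpace ℝ (Matrix ι ι ℝ) := inferInstanceAs (LocallyConvexSpace ℝ (ι → ι → ℝ))
  inferInstance

/-- The trace form as a bilinear map. -/
def traceForm : SymMat ι →ₗ[ℝ] SymMat ι →ₗ[ℝ] ℝ :=
  LinearMap.mk₂ ℝ (fun X H => traceInner H X)
    (fun X Y H => by simp [traceInner, Matrix.mul_add])
    (fun c X H => by simp [traceInner])
    (fun X H K => by simp [traceInner, Matrix.add_mul])
    (fun c X H => by simp [traceInner])

theorem traceForm_apply (H X : SymMat ι) : traceForm H X = traceInner X H := rfl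

theorem traceInner_self_eq_zero {X : SymMat ι} (h : traceInner X X = 0) : X = 0 := by
  have hX : (X : Matrix ι ι ℝ).IsSymm := X.2
  have h1 : ∑ i, ∑ j, (X : Matrix ι ι ℝ) i j ^ 2 = 0 := by
    rw [← h]
    simp only [traceInner, Matrix.trace, Matrix.diag, Matrix.mul_apply]
    refine Finset.sum_congr rfl fun i _ => Finset.sum_congr rfl fun j _ => ?_
    rw [sq, hX.apply i j]
  ext i j
  rw [Finset.sum_eq_zero_iff_of_nonneg fun i _ => by positivity] at h1
  have h2 := h1 i (Finset.mem_univ _)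
  rw [Finset.sum_eq_zero_iff_of_nonneg fun i _ => by positivity] at h2
  simpa using h2 j (Finset.mem_univ _)

/-- Riesz representation for the trace form: it is definite, and in finite dimension an injective
map to the dual is onto. It turns a separating functional into a direction H. -/
theorem exists_traceInner_eq (f : SymMat ι →ₗ[ℝ] ℝ) : ∃ H, ∀ X, f X = traceInner X H := by
  have hinj : Function.Injective (traceForm : SymMat ι →ₗ[ℝ] SymMat ι →ₗ[ℝ] ℝ) := by
    refine (injective_iff_map_eq_zero _).2 fun X hX => traceInner_self_eq_zero ?_
    rw [← traceForm_apply, hX, LinearMap.zero_apply]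
  have hsurj := (LinearMap.injective_iff_surjective_of_finrank_eq_finrank
    (Subspace.dual_finrank_eq (K := ℝ) (V := SymMat ι)).symm).1 hinj
  obtain ⟨H, hH⟩ := hsurj f
  exact ⟨H, fun X => by rw [← traceForm_apply, hH]⟩

theorem traceInner_negHalfOuter (x y : ι → ℝ) (H : SymMat ι) :
    traceInner (negHalfOuter x y) H = -(1 / 2) * pairForm (H : Matrix ι ι ℝ) (x, y) := by
  have h : ∀ x : ι → ℝ, Matrix.trace (Matrix.vecMulVec x x * (H : Matrix ι ι ℝ)) =
      x ⬝ᵥ (H : Matrix ι ι ℝ) *ᵥ x := fun x => by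
    rw [Matrix.vecMulVec_mul, Matrix.trace_vecMulVec, dotProduct_comm, Matrix.dotProduct_mulVec]
  simp only [traceInner, negHalfOuter, Matrix.neg_mul, Matrix.smul_mul, Matrix.add_mul,
    Matrix.trace_neg, Matrix.trace_smul, Matrix.trace_add, h, pairForm, smul_eq_mul]
  ring

theorem michelPenotSubdiff_subset_clarkeSubdiff (f : SymMat ι → EReal) (A : SymMat ι) :
    michelPenotSubdiff f A ⊆ clarkeSubdiff f A :=
  fun _ hX H => (hX H).trans (michelPenotDeriv_le_clarkeDeriv f A H)

theorem continuous_traceInner_left (H : SymMat ι) : Continuous fun X => traceInner X H :=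
  (traceForm H).continuous_of_finiteDimensional

/-- Each constraint is the preimage of a closed down-set of ℝ under a linear functional, even where
the derivative is ±∞. Closedness and convexity follow. -/
theorem michelPenotSubdiff_eq_iInter (f : SymMat ι → EReal) (A : SymMat ι) :
    michelPenotSubdiff f A =
      ⋂ H, (traceForm H) ⁻¹' {r : ℝ | (r : EReal) ≤ michelPenotDeriv f A H} := by
  ext X
  simp [michelPenotSubdiff, traceForm_apply]

theorem isClosed_michelPenotSubdiff (f : SymMat ι → EReal) (A : SymMat ι) :
    IsClosed (michelPenotSubdiff f A) := by
  rw [michelPenotSubdiff_eq_iInter]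
  exact isClosed_iInter fun H => (isClosed_Iic.preimage continuous_coe_real_ereal).preimage
    (continuous_traceInner_left H)

theorem convex_michelPenotSubdiff (f : SymMat ι → EReal) (A : SymMat ι) :
    Convex ℝ (michelPenotSubdiff f A) := by
  rw [michelPenotSubdiff_eq_iInter]
  refine convex_iInter fun H => Convex.linear_preimage (Set.OrdConnected.convex ⟨?_⟩) _
  exact fun a _ b hb c hc => (EReal.coe_le_coe_iff.2 hc.2).trans hb

end SymMat

variable {n : ℕ}

theorem closedConvexHull_subset_michelPenotSubdiff {A : SymMat (Fin n ⊕ Fin n)}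
    (hA : (A : Matrix (Fin n ⊕ Fin n) (Fin n ⊕ Fin n) ℝ).PosDef) (m : Fin n) :
    closedConvexHull ℝ ((fun p => negHalfOuter p.1 p.2) ''
      normalisedSympEigPairs (A : Matrix (Fin n ⊕ Fin n) (Fin n ⊕ Fin n) ℝ) m) ⊆
      SymMat.michelPenotSubdiff (negSympEig m) A := by
  refine closedConvexHull_min ?_ (SymMat.convex_michelPenotSubdiff _ _)
    (SymMat.isClosed_michelPenotSubdiff _ _)
  rintro _ ⟨z, hz, rfl⟩ H
  rw [SymMat.traceInner_negHalfOuter]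
  exact le_michelPenotDeriv_negSympEig hA m H hz

/-- A point outside the hull is separated by some ⟨·, H⟩ with a level u strictly above its values on
the generators; this is the strict bound required by `clarkeDeriv_negSympEig_le`, so the Clarke
derivative along H is at most u, while ⟨X, H⟩ > u. -/
theorem clarkeSubdiff_subset_closedConvexHull {A : SymMat (Fin n ⊕ Fin n)}
    (hA : (A : Matrix (Fin n ⊕ Fin n) (Fin n ⊕ Fin n) ℝ).PosDef) (m : Fin n) :
    SymMat.clarkeSubdiff (negSympEig m) A ⊆
      closedConvexHull ℝ ((fun p => negHalfOuter p.1 p.2) ''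
        normalisedSympEigPairs (A : Matrix (Fin n ⊕ Fin n) (Fin n ⊕ Fin n) ℝ) m) := by
  intro X hX
  by_contra hXC
  obtain ⟨f, u, hf, hu⟩ := geometric_hahn_banach_closed_point convex_closedConvexHull
    isClosed_closedConvexHull hXC
  obtain ⟨H, hH⟩ := SymMat.exists_traceInner_eq f.toLinearMap
  have hle := (hX H).trans (clarkeDeriv_negSympEig_le hA m H (c := u) fun z hz => by
    have h1 := hf _ (subset_closedConvexHull (Set.mem_image_of_mem _ hz))
    have h2 := hH (negHalfOuter z.1 z.2)
    rw [SymMat.traceInner_negHalfOuter] at h2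
    rw [← h2]
    exact h1)
  rw [EReal.coe_le_coe_iff, ← hH] at hle
  exact hle.not_gt hu

end Subdifferential

theorem mainTheorem2 {n : ℕ} (A : SymMat (Fin n ⊕ Fin n))
    (hA : (A : Matrix (Fin n ⊕ Fin n) (Fin n ⊕ Fin n) ℝ).PosDef) :
    (∀ m : Fin n,
      SymMat.clarkeSubdiff (negSympEig m) A = SymMat.michelPenotSubdiff (negSympEig m) A ∧
      SymMat.michelPenotSubdiff (negSympEig m) A =
        closedConvexHull ℝ ((fun p => negHalfOuter p.1 p.2) ''
          normalisedSympEigPairs (A : Matrix (Fin n ⊕ Fin n) (Fin n ⊕ Fin n) ℝ) m)) ∧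
    (∀ m k : Fin n,
      sympEig (A : Matrix (Fin n ⊕ Fin n) (Fin n ⊕ Fin n) ℝ) m =
        sympEig (A : Matrix (Fin n ⊕ Fin n) (Fin n ⊕ Fin n) ℝ) k →
      SymMat.clarkeSubdiff (negSympEig m) A = SymMat.clarkeSubdiff (negSympEig k) A ∧
      SymMat.michelPenotSubdiff (negSympEig m) A =
        SymMat.michelPenotSubdiff (negSympEig k) A) := by
  have hmain : ∀ m : Fin n,
      SymMat.clarkeSubdiff (negSympEig m) A = SymMat.michelPenotSubdiff (negSympEig m) A ∧
      SymMat.michelPenotSubdiff (negSympEig m) A =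
        closedConvexHull ℝ ((fun p => negHalfOuter p.1 p.2) ''
          normalisedSympEigPairs (A : Matrix (Fin n ⊕ Fin n) (Fin n ⊕ Fin n) ℝ) m) := fun m => by
    have h1 := closedConvexHull_subset_michelPenotSubdiff hA m
    have h2 := SymMat.michelPenotSubdiff_subset_clarkeSubdiff (negSympEig m) A
    have h3 := clarkeSubdiff_subset_closedConvexHull hA m
    exact ⟨(h3.trans h1).antisymm h2, (h2.trans h3).antisymm h1⟩
  refine ⟨hmain, fun m k hmk => ?_⟩
  -- The set of pairs depends on the index only through the eigenvalue.
  have hpairs : normalisedSympEigPairs (A : Matrix (Fin n ⊕ Fin n) (Fin n ⊕ Fin n) ℝ) m =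
      normalisedSympEigPairs (A : Matrix (Fin n ⊕ Fin n) (Fin n ⊕ Fin n) ℝ) k := by
    simp only [normalisedSympEigPairs, hmk]
  have hMP : SymMat.michelPenotSubdiff (negSympEig m) A =
      SymMat.michelPenotSubdiff (negSympEig k) A := by
    rw [(hmain m).2, (hmain k).2, hpairs]
  exact ⟨by rw [(hmain m).1, (hmain k).1, hMP], hMP⟩
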